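/- **Setting.** Let $d\in\{2,3\}$ and let $\Omega\subset\mathbb R^d$ be a bounded domain with Lipschitz boundary, $n$ its outward unit normal (at the boundary points near which $\partial\Omega$ is $C^1$). Let $b\in C^\infty(\Omega)^d\cap C(\overline\Omega)^d$ with $|b|=1$ in $\Omega$, and put $\Gamma_D=\{x\in\partial\Omega: b\cdot n=0\}$, $\Gamma_{in}=\{x\in\partial\Omega: b\cdot n<0\}$. Assume that $\Gamma_D$ has nonempty relative interior in $\partial\Omega$ and that the field lines are open and enter through $\Gamma_{in}$: for almost every $x\in\Omega$, the integral curve of $b$ through $x$, followed backwards, stays in $\Omega$ until it reaches a point of $\Gamma_{in}$ in finite time. Let $A_\|:\Omega\to\mathbb R$ and $A_\perp:\Omega\to\mathbb R^{d\times d}$ be measurable (for example $W^{2,\infty}$) such that, for some constants $0<A_0\le A_1$ and almost every $x\in\Omega$, $A_0\le A_\|(x)\le A_1$ and $A_0|v|^2\le v^tA_\perp(x)v\le A_1|v|^2$ for all $v\perp b(x)$, and $A_\perp(x)$ is symmetric on $b(x)^\perp$. Put $A=(b\otimes b)A_\|(b\otimes b)+(Id-b\otimes b)A_\perp(Id-b\otimes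 b)$, $\nabla_\|v=(b\cdot\nabla v)\,b$, $$\mathcal V=\{v\in H^1(\Omega): v|_{\Gamma_D}=0\},\qquad \mathcal L_{in}=\{q\in L^2(\Omega):\nabla_\|q\in L^2(\Omega),\ q|_{\Gamma_{in}}=0\},$$ $$a(u,v)=\int_\Omega A\nabla u\cdot\nabla v,\quad a_\|(u,v)=\int_\Omega A_\|\nabla_\|u\cdot\nabla_\|v,\quad |v|_{\mathcal V}=a(v,v)^{1/2},\quad |v|_\|=a_\|(v,v)^{1/2},$$ and let $\mathcal V'$ be the dual of $(\mathcal V,|\cdot|_{\mathcal V})$, with $\|f\|_{\mathcal V'}=\sup_{v\in\mathcal V}f(v)/|v|_{\mathcal V}$. Let $\mathcal T_h$ be a conforming mesh of $\Omega$ by simplices (resp. rectangles/boxes) of maximal diameter $h>0$, let $V_h\subset\mathcal V$ be the space of continuous $\mathbb P_k$ (resp. $\mathbb Q_k$) finite elements on $\mathcal T_h$ that belong to $\mathcal V$, and let $L_h=V_h\cap\mathcal L_{in}$. On $X_h=V_h\times L_h$ put $$|q_h|_{*h}=\sup_{v_h\in V_h}\frac{a_\|(q_h,v_h)}{|v_h|_{\mathcal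 V}},\qquad \|u_h,q_h\|_{X_{\varepsilon,h}}=\big(|u_h|_{\mathcal V}^2+|q_h|_{*h}^2+\varepsilon|q_h|_\|^2\big)^{1/2},$$ $$C_\varepsilon((u,q),(v,w))=a(u,v)+(1-\varepsilon)a_\|(q,v)+a_\|(u,w)-\varepsilon a_\|(q,w).$$ For $f\in\mathcal V'$ and $\varepsilon\ge0$, the discrete problem $(AP_{in})^\varepsilon_h$ is: find $(u_h^\varepsilon,q_h^\varepsilon)\in V_h\times L_h$ with $$a(u_h^\varepsilon,v_h)+(1-\varepsilon)a_\|(q_h^\varepsilon,v_h)=f(v_h)\ \ \forall v_h\in V_h,\qquad a_\|(u_h^\varepsilon,w_h)-\varepsilon a_\|(q_h^\varepsilon,w_h)=0\ \ \forall w_h\in L_h.$$ **Theorem.** For every $\varepsilon_{\max}$ (in particular $\varepsilon_{\max}=1$) there is a constant $\beta>0$, depending only on $\varepsilon_{\max}$ (so neither on $\varepsilon$, nor on the mesh, nor on the data), such that in every setting as above: 1. for all $\varepsilon\in[0,\varepsilon_{\max}]$, the discrete inf-sup condition $\displaystyle\inf_{\Phi\in X_h}\sup_{\Psi\in X_h}\frac{C_\varepsilon(\Phi,\Psi)}{\|\Phi\|_{X_{\varepsilon,h}}\|\Psi\|_{X_{\varepsilon,h}}}\ge\beta$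 holds; 2. for every $f\in\mathcal V'$ and every $\varepsilon\ge0$, the problem $(AP_{in})^\varepsilon_h$ has a unique solution $(u_h^\varepsilon,q_h^\varepsilon)\in V_h\times L_h$; 3. for every $\varepsilon\in[0,\varepsilon_{\max}]$ it satisfies $\|u_h^\varepsilon,q_h^\varepsilon\|_{X_{\varepsilon,h}}\le\frac1\beta\|f\|_{\mathcal V'}$; 4. $\|u_h^\varepsilon-u_h^0,\,q_h^\varepsilon-q_h^0\|_{X_{\varepsilon,h}}\to0$ as $\varepsilon\to0^+$; 5. for any bases of $V_h$ and $L_h$ (the same for all $\varepsilon$), the matrix $\mathbb A^\varepsilon$ of the linear system $(AP_{in})^\varepsilon_h$ is invertible and its condition number $\|\mathbb A^\varepsilon\|_2\|(\mathbb A^\varepsilon)^{-1}\|_2$ is bounded, for $\varepsilon\in[0,\varepsilon_{\max}]$, by a constant independent of $\varepsilon$. -/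

import Mathlib

open MeasureTheory Filter Topology Set
open scoped ContDiff

noncomputable section

/-- `ℝ^d` with its Euclidean norm. -/
abbrev Euc (d : ℕ) : Type := EuclideanSpace ℝ (Fin d)

/-! ### Domains, normals, weak derivatives, traces -/

/-- Lipschitz boundary: near each boundary point, `Ω` is the subgraph, in some unit direction `e`,
of a Lipschitz function of the component orthogonal to `e`. -/
def HasLipschitzBoundary {d : ℕ} (Ω : Set (Euc d)) : Prop :=
  ∀ x ∈ frontier Ω, ∃ (e : Euc d) (K : NNReal) (ψ : Euc d → ℝ), ‖e‖ = 1 ∧ LipschitzWith K ψ ∧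
    ∀ᶠ y in 𝓝 x, (y ∈ Ω ↔ inner ℝ y e < ψ (y - (inner ℝ y e : ℝ) • e))

/-- `n` is the outward unit normal of `Ω` at the boundary point `x`: near `x` the boundary is
`C¹`, i.e. `Ω = {ρ < 0}` there with `ρ` of class `C¹`, and `∇ρ(x)` is a positive multiple of `n`.
At edges and corners of a polyhedral domain there is no such `n`. -/
def IsOuterNormal {d : ℕ} (Ω : Set (Euc d)) (x n : Euc d) : Prop :=
  x ∈ frontier Ω ∧ ‖n‖ = 1 ∧ ∃ ρ : Euc d → ℝ, ContDiffAt ℝ 1 ρ x ∧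
    (∀ᶠ y in 𝓝 x, (y ∈ Ω ↔ ρ y < 0)) ∧ ∃ c : ℝ, 0 < c ∧ gradient ρ x = c • n

/-- Test functions `C_c^∞(Ω)`. -/
def IsTestFun {d : ℕ} (Ω : Set (Euc d)) (φ : Euc d → ℝ) : Prop :=
  ContDiff ℝ ∞ φ ∧ HasCompactSupport φ ∧ tsupport φ ⊆ Ω

/-- `L²(Ω; F)`, functions up to equality almost everywhere in `Ω`. -/
abbrev L2 {d : ℕ} (Ω : Set (Euc d)) (F : Type) [NormedAddCommGroup F] : Type :=
  Lp F 2 (volume.restrict Ω)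

/-- `g = ∇v` in the sense of distributions in `Ω`. -/
def IsWeakGradient {d : ℕ} (Ω : Set (Euc d)) (v : L2 Ω ℝ) (g : L2 Ω (Euc d)) : Prop :=
  ∀ φ : Euc d → ℝ, IsTestFun Ω φ → ∀ e : Euc d,
    ∫ x in Ω, v x * fderiv ℝ φ x e = -∫ x in Ω, (inner ℝ (g x) e : ℝ) * φ x

/-- The divergence of a vector field. -/
def divergence {d : ℕ} (b : Euc d → Euc d) (x : Euc d) : ℝ :=
  ∑ i : Fin d, fderiv ℝ b x (EuclideanSpace.single i 1) i

/-- `g = b · ∇q` in the sense of distributions in `Ω`: the pairing of `q` with `∇ · (φ b)` is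
minus the pairing of `g` with `φ`. -/
def IsWeakFieldDeriv {d : ℕ} (Ω : Set (Euc d)) (b : Euc d → Euc d) (q g : L2 Ω ℝ) : Prop :=
  ∀ φ : Euc d → ℝ, IsTestFun Ω φ →
    ∫ x in Ω, q x * (fderiv ℝ φ x (b x) + φ x * divergence b x) = -∫ x in Ω, g x * φ x

/-- `v|_S = 0` in the sense of traces, for `S ⊆ ∂Ω`: for almost every `x ∈ S` with respect to
the surface measure (the `(d-1)`-dimensional Hausdorff measure), the mean of `|v|` over
`B(x,r) ∩ Ω` tends to `0` with `r`. (For Sobolev functions on Lipschitz domains the trace at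
almost every boundary point is the number `t` such that the means of `|v - t|` tend to `0`.) -/
def TraceZeroOn {d : ℕ} (Ω S : Set (Euc d)) (v : L2 Ω ℝ) : Prop :=
  ∀ᵐ x ∂(Measure.hausdorffMeasure ((d : ℝ) - 1) : Measure (Euc d)), x ∈ S →
    Tendsto (fun r : ℝ => ⨍ y in Metric.ball x r ∩ Ω, |v y|) (𝓝[>] 0) (𝓝 0)

/-! Closure of these notions under linear combinations, so that the spaces below are subspaces. -/

theorem IsTestFun.memLp_fderiv {d : ℕ} {Ω : Set (Euc d)} {φ : Euc d → ℝ} (h : IsTestFun Ω φ)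
    (e : Euc d) : MemLp (fun x => fderiv ℝ φ x e) 2 (volume.restrict Ω) := by
  have hc : Continuous fun x => fderiv ℝ φ x e :=
    (h.1.continuous_fderiv (by simp)).clm_apply continuous_const
  have hs : HasCompactSupport fun x => fderiv ℝ φ x e := h.2.1.fderiv_apply (𝕜 := ℝ) e
  exact (hc.memLp_of_hasCompactSupport hs).restrict Ω

theorem IsTestFun.memLp {d : ℕ} {Ω : Set (Euc d)} {φ : Euc d → ℝ} (h : IsTestFun Ω φ) :
    MemLp φ 2 (volume.restrict Ω) :=
  (h.1.continuous.memLp_of_hasCompactSupport h.2.1).restrict Ω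

theorem IsWeakGradient.zero {d : ℕ} (Ω : Set (Euc d)) : IsWeakGradient Ω 0 0 := by
  intro φ _ e
  have h1 : ∫ x in Ω, (0 : L2 Ω ℝ) x * fderiv ℝ φ x e = 0 := by
    rw [integral_congr_ae (g := fun _ => (0 : ℝ)), integral_zero]
    filter_upwards [Lp.coeFn_zero ℝ 2 (volume.restrict Ω)] with x hx
    rw [hx, Pi.zero_apply, zero_mul]
  have h2 : ∫ x in Ω, (inner ℝ ((0 : L2 Ω (Euc d)) x) e : ℝ) * φ x = 0 := by
    rw [integral_congr_ae (g := fun _ => (0 : ℝ)), integral_zero]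
    filter_upwards [Lp.coeFn_zero (Euc d) 2 (volume.restrict Ω)] with x hx
    rw [hx, Pi.zero_apply, inner_zero_left, zero_mul]
  rw [h1, h2, neg_zero]

theorem IsWeakGradient.add {d : ℕ} {Ω : Set (Euc d)} {v w : L2 Ω ℝ} {g k : L2 Ω (Euc d)}
    (hv : IsWeakGradient Ω v g) (hw : IsWeakGradient Ω w k) :
    IsWeakGradient Ω (v + w) (g + k) := by
  intro φ hφ e
  have i1 : Integrable (fun x => v x * fderiv ℝ φ x e) (volume.restrict Ω) :=
    (Lp.memLp v).integrable_mul (hφ.memLp_fderiv e)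
  have i2 : Integrable (fun x => w x * fderiv ℝ φ x e) (volume.restrict Ω) :=
    (Lp.memLp w).integrable_mul (hφ.memLp_fderiv e)
  have i3 : Integrable (fun x => (inner ℝ (g x) e : ℝ) * φ x) (volume.restrict Ω) :=
    ((Lp.memLp g).inner_const e).integrable_mul hφ.memLp
  have i4 : Integrable (fun x => (inner ℝ (k x) e : ℝ) * φ x) (volume.restrict Ω) :=
    ((Lp.memLp k).inner_const e).integrable_mul hφ.memLp
  have h1 : ∫ x in Ω, (v + w) x * fderiv ℝ φ x e
      = ∫ x in Ω, (v x * fderiv ℝ φ x e + w x * fderiv ℝ φ x e) := by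
    apply integral_congr_ae
    filter_upwards [Lp.coeFn_add v w] with x hx
    rw [hx, Pi.add_apply, add_mul]
  have h2 : ∫ x in Ω, (inner ℝ ((g + k) x) e : ℝ) * φ x
      = ∫ x in Ω, ((inner ℝ (g x) e : ℝ) * φ x + (inner ℝ (k x) e : ℝ) * φ x) := by
    apply integral_congr_ae
    filter_upwards [Lp.coeFn_add g k] with x hx
    rw [hx, Pi.add_apply, inner_add_left, add_mul]
  rw [h1, h2, integral_add i1 i2, integral_add i3 i4, hv φ hφ e, hw φ hφ e]
  ring

theorem IsWeakGradient.smul {d : ℕ} {Ω : Set (Euc d)} {v : L2 Ω ℝ} {g : L2 Ω (Euc d)} (c : ℝ)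
    (hv : IsWeakGradient Ω v g) : IsWeakGradient Ω (c • v) (c • g) := by
  intro φ hφ e
  have h1 : ∫ x in Ω, (c • v) x * fderiv ℝ φ x e = ∫ x in Ω, c * (v x * fderiv ℝ φ x e) := by
    apply integral_congr_ae
    filter_upwards [Lp.coeFn_smul c v] with x hx
    simp [hx, mul_assoc]
  have h2 : ∫ x in Ω, (inner ℝ ((c • g) x) e : ℝ) * φ x
      = ∫ x in Ω, c * ((inner ℝ (g x) e : ℝ) * φ x) := by
    apply integral_congr_ae
    filter_upwards [Lp.coeFn_smul c g] with x hx
    simp [hx, real_inner_smul_left, mul_assoc]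
  rw [h1, h2, integral_const_mul, integral_const_mul, hv φ hφ e]
  ring

theorem IsTestFun.memLp_div {d : ℕ} {Ω : Set (Euc d)} {b : Euc d → Euc d} {φ : Euc d → ℝ}
    (hΩ : IsOpen Ω) (hb : ContDiffOn ℝ ∞ b Ω) (h : IsTestFun Ω φ) :
    MemLp (fun x => fderiv ℝ φ x (b x) + φ x * divergence b x) 2 (volume.restrict Ω) := by
  have hsub : tsupport (fun x => fderiv ℝ φ x (b x) + φ x * divergence b x) ⊆ tsupport φ := by
    refine closure_minimal (fun x hx => ?_) isClosed_closure
    by_contra hn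
    have h1 : φ x = 0 := image_eq_zero_of_notMem_tsupport hn
    have h2 : fderiv ℝ φ x = 0 := by
      by_contra h3
      exact hn (support_fderiv_subset ℝ h3)
    exact hx (by simp [h1, h2])
  have hc : Continuous fun x => fderiv ℝ φ x (b x) + φ x * divergence b x := by
    refine continuous_of_tsupport fun x hx => ?_
    have hxΩ : Ω ∈ 𝓝 x := hΩ.mem_nhds (h.2.2 (hsub hx))
    have hbx : ContDiffAt ℝ ∞ b x := hb.contDiffAt hxΩ
    have hdb : ContinuousAt (fderiv ℝ b) x := hbx.continuousAt_fderiv (by simp)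
    have hdiv : ContinuousAt (divergence b) x := by
      unfold divergence
      refine tendsto_finsetSum _ fun i _ => ?_
      have := hdb.clm_apply (continuousAt_const (y := EuclideanSpace.single i (1 : ℝ)))
      exact ((EuclideanSpace.proj (𝕜 := ℝ) i).continuous.continuousAt).comp this
    exact (((h.1.continuous_fderiv (by simp)).continuousAt).clm_apply hbx.continuousAt).add
      (h.1.continuous.continuousAt.mul hdiv)
  have hs : HasCompactSupport fun x => fderiv ℝ φ x (b x) + φ x * divergence b x :=
    h.2.1.of_isClosed_subset isClosed_closure hsub
  exact (hc.memLp_of_hasCompactSupport hs).restrict Ω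

theorem IsWeakFieldDeriv.zero {d : ℕ} (Ω : Set (Euc d)) (b : Euc d → Euc d) :
    IsWeakFieldDeriv Ω b 0 0 := by
  intro φ _
  have h0 := Lp.coeFn_zero ℝ 2 (volume.restrict Ω)
  have h1 : ∫ x in Ω, (0 : L2 Ω ℝ) x * (fderiv ℝ φ x (b x) + φ x * divergence b x) = 0 := by
    rw [integral_congr_ae (g := fun _ => (0 : ℝ)), integral_zero]
    filter_upwards [h0] with x hx
    rw [hx, Pi.zero_apply, zero_mul]
  have h2 : ∫ x in Ω, (0 : L2 Ω ℝ) x * φ x = 0 := by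
    rw [integral_congr_ae (g := fun _ => (0 : ℝ)), integral_zero]
    filter_upwards [h0] with x hx
    rw [hx, Pi.zero_apply, zero_mul]
  rw [h1, h2, neg_zero]

theorem IsWeakFieldDeriv.add {d : ℕ} {Ω : Set (Euc d)} {b : Euc d → Euc d} (hΩ : IsOpen Ω)
    (hb : ContDiffOn ℝ ∞ b Ω) {q r g k : L2 Ω ℝ} (hq : IsWeakFieldDeriv Ω b q g)
    (hr : IsWeakFieldDeriv Ω b r k) : IsWeakFieldDeriv Ω b (q + r) (g + k) := by
  intro φ hφ
  have hm := hφ.memLp_div hΩ hb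
  have i1 : Integrable (fun x => q x * (fderiv ℝ φ x (b x) + φ x * divergence b x))
      (volume.restrict Ω) := (Lp.memLp q).integrable_mul hm
  have i2 : Integrable (fun x => r x * (fderiv ℝ φ x (b x) + φ x * divergence b x))
      (volume.restrict Ω) := (Lp.memLp r).integrable_mul hm
  have i3 : Integrable (fun x => g x * φ x) (volume.restrict Ω) :=
    (Lp.memLp g).integrable_mul hφ.memLp
  have i4 : Integrable (fun x => k x * φ x) (volume.restrict Ω) :=
    (Lp.memLp k).integrable_mul hφ.memLp
  have h1 : ∫ x in Ω, (q + r) x * (fderiv ℝ φ x (b x) + φ x * divergence b x)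
      = ∫ x in Ω, (q x * (fderiv ℝ φ x (b x) + φ x * divergence b x)
          + r x * (fderiv ℝ φ x (b x) + φ x * divergence b x)) := by
    apply integral_congr_ae
    filter_upwards [Lp.coeFn_add q r] with x hx
    rw [hx, Pi.add_apply, add_mul]
  have h2 : ∫ x in Ω, (g + k) x * φ x = ∫ x in Ω, (g x * φ x + k x * φ x) := by
    apply integral_congr_ae
    filter_upwards [Lp.coeFn_add g k] with x hx
    rw [hx, Pi.add_apply, add_mul]
  rw [h1, h2, integral_add i1 i2, integral_add i3 i4, hq φ hφ, hr φ hφ]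
  ring

theorem IsWeakFieldDeriv.smul {d : ℕ} {Ω : Set (Euc d)} {b : Euc d → Euc d} {q g : L2 Ω ℝ}
    (c : ℝ) (hq : IsWeakFieldDeriv Ω b q g) : IsWeakFieldDeriv Ω b (c • q) (c • g) := by
  intro φ hφ
  have h1 : ∫ x in Ω, (c • q) x * (fderiv ℝ φ x (b x) + φ x * divergence b x)
      = ∫ x in Ω, c * (q x * (fderiv ℝ φ x (b x) + φ x * divergence b x)) := by
    apply integral_congr_ae
    filter_upwards [Lp.coeFn_smul c q] with x hx
    rw [hx, Pi.smul_apply, smul_eq_mul, mul_assoc]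
  have h2 : ∫ x in Ω, (c • g) x * φ x = ∫ x in Ω, c * (g x * φ x) := by
    apply integral_congr_ae
    filter_upwards [Lp.coeFn_smul c g] with x hx
    rw [hx, Pi.smul_apply, smul_eq_mul, mul_assoc]
  rw [h1, h2, integral_const_mul, integral_const_mul, hq φ hφ]
  ring

theorem L2.integrableOn_ball_inter {d : ℕ} {Ω : Set (Euc d)} (v : L2 Ω ℝ) (x : Euc d) (r : ℝ) :
    IntegrableOn (fun y => |v y|) (Metric.ball x r ∩ Ω) := by
  have h : MemLp v 2 (volume.restrict (Metric.ball x r ∩ Ω)) :=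
    (Lp.memLp v).mono_measure (Measure.restrict_mono inter_subset_right le_rfl)
  have : IsFiniteMeasure (volume.restrict (Metric.ball x r ∩ Ω)) :=
    ⟨by
      rw [Measure.restrict_apply_univ]
      exact (measure_mono inter_subset_left).trans_lt measure_ball_lt_top⟩
  exact (h.integrable (by norm_num)).abs

theorem L2.ae_ball_inter {d : ℕ} {Ω : Set (Euc d)} {p : Euc d → Prop}
    (h : ∀ᵐ y ∂(volume.restrict Ω), p y) (x : Euc d) (r : ℝ) :
    ∀ᵐ y ∂(volume.restrict (Metric.ball x r ∩ Ω)), p y :=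
  ae_mono (Measure.restrict_mono inter_subset_right le_rfl) h

theorem TraceZeroOn.zero {d : ℕ} (Ω S : Set (Euc d)) : TraceZeroOn Ω S 0 := by
  refine Eventually.of_forall fun x _ => ?_
  have h : (fun r : ℝ => ⨍ y in Metric.ball x r ∩ Ω, |(0 : L2 Ω ℝ) y|) = fun _ => 0 := by
    funext r
    rw [setAverage_eq, integral_congr_ae (g := fun _ => (0 : ℝ)), integral_zero, smul_zero]
    filter_upwards [L2.ae_ball_inter (Lp.coeFn_zero ℝ 2 (volume.restrict Ω)) x r] with y hy
    rw [hy, Pi.zero_apply, abs_zero]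
  rw [h]
  exact tendsto_const_nhds

theorem TraceZeroOn.add {d : ℕ} {Ω S : Set (Euc d)} {v w : L2 Ω ℝ} (hv : TraceZeroOn Ω S v)
    (hw : TraceZeroOn Ω S w) : TraceZeroOn Ω S (v + w) := by
  filter_upwards [hv, hw] with x h1 h2 hx
  have h := (h1 hx).add (h2 hx)
  rw [add_zero] at h
  refine squeeze_zero (fun r => ?_) (fun r => ?_) h
  · rw [setAverage_eq, smul_eq_mul]
    exact mul_nonneg (by positivity) (integral_nonneg fun y => abs_nonneg _)
  · simp only [setAverage_eq, smul_eq_mul]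
    rw [← mul_add, ← integral_add (L2.integrableOn_ball_inter v x r)
      (L2.integrableOn_ball_inter w x r)]
    refine mul_le_mul_of_nonneg_left ?_ (by positivity)
    refine integral_mono_ae (L2.integrableOn_ball_inter (v + w) x r)
      ((L2.integrableOn_ball_inter v x r).add (L2.integrableOn_ball_inter w x r)) ?_
    filter_upwards [L2.ae_ball_inter (Lp.coeFn_add v w) x r] with y hy
    simp only [hy, Pi.add_apply]
    exact abs_add_le _ _

theorem TraceZeroOn.smul {d : ℕ} {Ω S : Set (Euc d)} {v : L2 Ω ℝ} (c : ℝ)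
    (hv : TraceZeroOn Ω S v) : TraceZeroOn Ω S (c • v) := by
  filter_upwards [hv] with x h1 hx
  have h := (h1 hx).const_mul |c|
  rw [mul_zero] at h
  refine h.congr fun r => ?_
  simp only [setAverage_eq, smul_eq_mul]
  rw [mul_left_comm, ← integral_const_mul]
  congr 1
  apply integral_congr_ae
  filter_upwards [L2.ae_ball_inter (Lp.coeFn_smul c v) x r] with y hy
  simp [hy, abs_mul]

/-- The Sobolev space `H¹(Ω)`. An element is a pair `(v, ∇v)` of an `L²` function and its weak
gradient (which is determined by `v`), assumed to be in `L²`. -/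
def H1 {d : ℕ} (Ω : Set (Euc d)) : Submodule ℝ (L2 Ω ℝ × L2 Ω (Euc d)) where
  carrier := {v | IsWeakGradient Ω v.1 v.2}
  zero_mem' := IsWeakGradient.zero Ω
  add_mem' := fun hv hw => IsWeakGradient.add hv hw
  smul_mem' := fun c _ hv => IsWeakGradient.smul c hv

/-! ### Meshes and finite elements -/

/-- Triangles / tetrahedra, or rectangles / boxes. -/
inductive CellShape
  | simplex
  | box

/-- The reference cell: the unit simplex or the unit cube. -/
def CellShape.refCell (d : ℕ) : CellShape → Set (Euc d)
  | .simplex => {x | (∀ i, 0 ≤ x i) ∧ ∑ i, x i ≤ 1}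
  | .box => {x | ∀ i, 0 ≤ x i ∧ x i ≤ 1}

/-- The polynomials used on the reference cell: `ℙ_k` (total degree at most `k`) on simplices,
`ℚ_k` (degree at most `k` in each variable) on boxes. -/
def CellShape.refPoly (d k : ℕ) : CellShape → Submodule ℝ (MvPolynomial (Fin d) ℝ)
  | .simplex => MvPolynomial.restrictTotalDegree (Fin d) ℝ k
  | .box => MvPolynomial.restrictDegree (Fin d) ℝ k

/-- A conforming mesh of `Ω` of maximal cell diameter `h`: finitely many cells, each the image of
the reference cell under an invertible affine map (with orthogonal edges for boxes, so that these
are genuine rectangles), with disjoint interiors, covering the closure of `Ω`, any two of them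
meeting in a common face or not at all. -/
structure FEMesh {d : ℕ} (Ω : Set (Euc d)) (s : CellShape) (h : ℝ) where
  numCells : ℕ
  map : Fin numCells → (Euc d ≃ᵃ[ℝ] Euc d)
  rectangular : s = CellShape.box → ∀ i, ∀ j l : Fin d, j ≠ l →
    inner ℝ ((map i).linear (EuclideanSpace.single j 1))
      ((map i).linear (EuclideanSpace.single l 1)) = (0 : ℝ)
  cover : ⋃ i, map i '' s.refCell d = closure Ω
  disjoint_interior : ∀ i j, i ≠ j →
    Disjoint (interior (map i '' s.refCell d)) (interior (map j '' s.refCell d))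
  conforming : ∀ i j,
    IsExposed ℝ (map i '' s.refCell d) (map i '' s.refCell d ∩ map j '' s.refCell d)
  size : IsGreatest (Set.range fun i => Metric.diam (map i '' s.refCell d)) h

/-- The continuous functions `w` on the closure of `Ω` which are, on every cell, `ℙ_k` (simplices)
or `ℚ_k` (boxes). -/
def FEMesh.IsPiecewisePoly {d : ℕ} {Ω : Set (Euc d)} {s : CellShape} {h : ℝ}
    (T : FEMesh Ω s h) (k : ℕ) (w : Euc d → ℝ) : Prop :=
  ContinuousOn w (closure Ω) ∧
    ∀ i, ∃ p ∈ s.refPoly d k, ∀ x ∈ s.refCell d, w (T.map i x) = MvPolynomial.eval (⇑x) p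

/-! ### The anisotropic problem -/

/-- The data: an open set `Ω`, a field `b` which is smooth in it, and the two diffusion
coefficients. -/
structure AnisotropicData (d : ℕ) where
  Ω : Set (Euc d)
  isOpen : IsOpen Ω
  b : Euc d → Euc d
  b_smooth : ContDiffOn ℝ ∞ b Ω
  Apar : Euc d → ℝ
  Aperp : Euc d → (Euc d →L[ℝ] Euc d)

namespace AnisotropicData

variable {d : ℕ} (D : AnisotropicData d)

/-- `Γ_D`, where the field is tangent to the boundary. -/
def ΓD : Set (Euc d) := {x | ∃ n, IsOuterNormal D.Ω x n ∧ inner ℝ (D.b x) n = (0 : ℝ)}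

/-- The inflow boundary `Γ_in`. -/
def Γin : Set (Euc d) := {x | ∃ n, IsOuterNormal D.Ω x n ∧ inner ℝ (D.b x) n < (0 : ℝ)}

/-- The projection `Id - b ⊗ b` at the point `x`. -/
def perp (x v : Euc d) : Euc d := v - (inner ℝ (D.b x) v : ℝ) • D.b x

/-- The matrix field `A = (b⊗b) A_∥ (b⊗b) + (Id - b⊗b) A_⊥ (Id - b⊗b)`, applied to `v`. -/
def A (x v : Euc d) : Euc d :=
  (D.Apar x * (inner ℝ (D.b x) v : ℝ)) • D.b x + D.perp x (D.Aperp x (D.perp x v))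

/-- The assumptions on the data: `Ω` is a bounded domain with Lipschitz boundary; `b` is a unit field
(smooth in `Ω`, continuous up to the boundary); measurable coefficients with the ellipticity bounds, `A_⊥` being
symmetric on the orthogonal complement of `b`; `Γ_D` with nonempty relative interior in `∂Ω`; and
almost every point of `Ω` lies on a field line which enters the domain through `Γ_in`. -/
structure Admissible : Prop where
  isConnected : IsConnected D.Ω
  isBounded : Bornology.IsBounded D.Ω
  lipschitz : HasLipschitzBoundary D.Ω
  b_continuous : ContinuousOn D.b (closure D.Ω)
  b_unit : ∀ x ∈ D.Ω, ‖D.b x‖ = 1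
  Apar_meas : AEStronglyMeasurable D.Apar (volume.restrict D.Ω)
  Aperp_meas : AEStronglyMeasurable D.Aperp (volume.restrict D.Ω)
  Aperp_symm : ∀ᵐ x ∂(volume.restrict D.Ω), ∀ v w : Euc d,
    inner ℝ v (D.b x) = (0 : ℝ) → inner ℝ w (D.b x) = (0 : ℝ) →
      (inner ℝ (D.Aperp x v) w : ℝ) = inner ℝ v (D.Aperp x w)
  bounds : ∃ A₀ A₁ : ℝ, 0 < A₀ ∧ A₀ ≤ A₁ ∧ ∀ᵐ x ∂(volume.restrict D.Ω),
    (A₀ ≤ D.Apar x ∧ D.Apar x ≤ A₁) ∧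
    ∀ v : Euc d, inner ℝ v (D.b x) = (0 : ℝ) →
      A₀ * ‖v‖ ^ 2 ≤ inner ℝ v (D.Aperp x v) ∧ inner ℝ v (D.Aperp x v) ≤ A₁ * ‖v‖ ^ 2
  ΓD_interior : ∃ x ∈ D.ΓD, ∀ᶠ y in 𝓝[frontier D.Ω] x, y ∈ D.ΓD
  field_lines : ∀ᵐ x ∂(volume.restrict D.Ω), ∃ (τ : ℝ) (γ : ℝ → Euc d), 0 < τ ∧
    ContinuousOn γ (Icc 0 τ) ∧ γ 0 ∈ D.Γin ∧ γ τ = x ∧ (∀ t ∈ Ioc 0 τ, γ t ∈ D.Ω) ∧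
    ∀ t ∈ Ioo 0 τ, HasDerivAt γ (D.b (γ t)) t

/-- `𝒱 = {v ∈ H¹(Ω) : v = 0 on Γ_D}`. -/
def V : Submodule ℝ (L2 D.Ω ℝ × L2 D.Ω (Euc d)) where
  carrier := {v | v ∈ H1 D.Ω ∧ TraceZeroOn D.Ω D.ΓD v.1}
  zero_mem' := ⟨(H1 D.Ω).zero_mem, TraceZeroOn.zero _ _⟩
  add_mem' := fun hv hw => ⟨(H1 D.Ω).add_mem hv.1 hw.1, hv.2.add hw.2⟩
  smul_mem' := fun c _ hv => ⟨(H1 D.Ω).smul_mem c hv.1, hv.2.smul c⟩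

/-- The function underlying an element of `𝒱`. -/
def val {D : AnisotropicData d} : D.V →ₗ[ℝ] L2 D.Ω ℝ := LinearMap.fst ℝ _ _ ∘ₗ D.V.subtype

/-- The weak gradient of an element of `𝒱`. -/
def grad {D : AnisotropicData d} (v : D.V) : L2 D.Ω (Euc d) := v.1.2

/-- `ℒ_in`: those `q ∈ L²(Ω)` with `∇_∥ q = (b · ∇q) b ∈ L²(Ω)` (equivalently `b · ∇q ∈ L²(Ω)`,
as `|b| = 1`) and `q = 0` on `Γ_in`. -/
def Lin : Submodule ℝ (L2 D.Ω ℝ) where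
  carrier := {q | (∃ g : L2 D.Ω ℝ, IsWeakFieldDeriv D.Ω D.b q g) ∧ TraceZeroOn D.Ω D.Γin q}
  zero_mem' := ⟨⟨0, IsWeakFieldDeriv.zero _ _⟩, TraceZeroOn.zero _ _⟩
  add_mem' := by
    rintro q r ⟨⟨g, hg⟩, hq⟩ ⟨⟨k, hk⟩, hr⟩
    exact ⟨⟨g + k, hg.add D.isOpen D.b_smooth hk⟩, hq.add hr⟩
  smul_mem' := by
    rintro c q ⟨⟨g, hg⟩, hq⟩
    exact ⟨⟨c • g, hg.smul c⟩, hq.smul c⟩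

/-- `a(u,v) = ∫_Ω A ∇u · ∇v`. -/
def a (u v : D.V) : ℝ := ∫ x in D.Ω, (inner ℝ (D.A x (grad u x)) (grad v x) : ℝ)

/-- `∇_∥ v = (b · ∇v) b`. -/
def gradPar (v : D.V) (x : Euc d) : Euc d := (inner ℝ (D.b x) (grad v x) : ℝ) • D.b x

/-- `a_∥(u,v) = ∫_Ω A_∥ ∇_∥u · ∇_∥v`. -/
def aPar (u v : D.V) : ℝ := ∫ x in D.Ω, D.Apar x * (inner ℝ (D.gradPar u x) (D.gradPar v x) : ℝ)

/-- `|v|_𝒱 = a(v,v)^{1/2}`. -/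
def normV (v : D.V) : ℝ := √(D.a v v)

/-- `|v|_∥ = a_∥(v,v)^{1/2}`. -/
def normPar (v : D.V) : ℝ := √(D.aPar v v)

/-- `f ∈ 𝒱'`: boundedness of the linear functional `f` for the norm `|·|_𝒱`. -/
def IsBoundedFunctional (f : D.V →ₗ[ℝ] ℝ) : Prop := ∃ C : ℝ, ∀ v, |f v| ≤ C * D.normV v

/-- `‖f‖_{𝒱'}`, the supremum of `f(v) / |v|_𝒱`. -/
def dualNorm (f : D.V →ₗ[ℝ] ℝ) : ℝ := ⨆ v : D.V, f v / D.normV v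

/-! ### The discrete problem -/

variable {s : CellShape} {h : ℝ} (T : FEMesh D.Ω s h) (k : ℕ)

/-- The finite element space `V_h ⊆ 𝒱`. -/
def Vh : Submodule ℝ D.V where
  carrier := {v | ∃ w : Euc d → ℝ, T.IsPiecewisePoly k w ∧ val v =ᵐ[volume.restrict D.Ω] w}
  zero_mem' := ⟨0, ⟨continuousOn_const, fun _ => ⟨0, Submodule.zero_mem _, fun _ _ => by simp⟩⟩,
    Lp.coeFn_zero ℝ 2 (volume.restrict D.Ω)⟩
  add_mem' := by
    rintro u v ⟨w, ⟨hw, hp⟩, huw⟩ ⟨w', ⟨hw', hp'⟩, hvw⟩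
    refine ⟨w + w', ⟨hw.add hw', fun i => ?_⟩, ?_⟩
    · obtain ⟨p, hpm, hpe⟩ := hp i
      obtain ⟨p', hpm', hpe'⟩ := hp' i
      exact ⟨p + p', Submodule.add_mem _ hpm hpm', fun x hx => by
        simp [hpe x hx, hpe' x hx]⟩
    · exact (Lp.coeFn_add (val u) (val v)).trans (huw.add hvw)
  smul_mem' := by
    rintro c u ⟨w, ⟨hw, hp⟩, huw⟩
    refine ⟨c • w, ⟨hw.const_smul c, fun i => ?_⟩, ?_⟩
    · obtain ⟨p, hpm, hpe⟩ := hp i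
      exact ⟨c • p, Submodule.smul_mem _ c hpm, fun x hx => by simp [hpe x hx]⟩
    · refine (Lp.coeFn_smul c (val u)).trans ?_
      filter_upwards [huw] with x hx
      simp [hx]

/-- The finite element space `L_h = V_h ∩ ℒ_in`. -/
def Lh : Submodule ℝ D.V := D.Vh T k ⊓ D.Lin.comap val

/-- The mesh-dependent norm `|q|_{*h}`, the supremum over `v ∈ V_h` of `a_∥(q,v) / |v|_𝒱`. -/
def normStar (q : D.V) : ℝ := ⨆ v : D.Vh T k, D.aPar q v / D.normV v

/-- `‖u,q‖_{X_{ε,h}} = (|u|_𝒱² + |q|_{*h}² + ε |q|_∥²)^{1/2}` on `X_h = V_h × L_h`. -/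
def normX (ε : ℝ) (Φ : D.Vh T k × D.Lh T k) : ℝ :=
  √(D.normV Φ.1 ^ 2 + D.normStar T k Φ.2 ^ 2 + ε * D.normPar Φ.2 ^ 2)

/-- `C_ε((u,q),(v,w)) = a(u,v) + (1-ε) a_∥(q,v) + a_∥(u,w) - ε a_∥(q,w)`. -/
def C (ε : ℝ) (Φ Ψ : D.Vh T k × D.Lh T k) : ℝ :=
  D.a Φ.1 Ψ.1 + (1 - ε) * D.aPar Φ.2 Ψ.1 + D.aPar Φ.1 Ψ.2 - ε * D.aPar Φ.2 Ψ.2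

/-- The discrete inf-sup condition with constant `β`: for every `Φ ∈ X_h`, the supremum over `Ψ`
of `C_ε(Φ,Ψ) / ‖Ψ‖` is at least `β ‖Φ‖`. -/
def DiscreteInfSup (ε β : ℝ) : Prop :=
  ∀ Φ : D.Vh T k × D.Lh T k,
    β * D.normX T k ε Φ ≤ ⨆ Ψ : D.Vh T k × D.Lh T k, D.C T k ε Φ Ψ / D.normX T k ε Ψ

/-- `Φ = (u_h, q_h) ∈ V_h × L_h` solves the discrete problem with parameter `ε`. -/
def IsDiscreteSolution (ε : ℝ) (f : D.V →ₗ[ℝ] ℝ) (Φ : D.Vh T k × D.Lh T k) : Prop :=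
  (∀ v : D.Vh T k, D.a Φ.1 v + (1 - ε) * D.aPar Φ.2 v = f v) ∧
  (∀ w : D.Lh T k, D.aPar Φ.1 w - ε * D.aPar Φ.2 w = 0)

/-- The matrix of the discrete problem in given bases of `V_h` and `L_h` (rows correspond to
test functions, columns to unknowns). -/
def systemMatrix {m n : ℕ} (βu : Module.Basis (Fin m) ℝ (D.Vh T k))
    (βq : Module.Basis (Fin n) ℝ (D.Lh T k)) (ε : ℝ) :
    Matrix (Fin m ⊕ Fin n) (Fin m ⊕ Fin n) ℝ :=
  Matrix.fromBlocks
    (Matrix.of fun i j => D.a (βu j) (βu i))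
    (Matrix.of fun i j => (1 - ε) * D.aPar (βq j) (βu i))
    (Matrix.of fun i j => D.aPar (βu j) (βq i))
    (Matrix.of fun i j => -(ε * D.aPar (βq j) (βq i)))

end AnisotropicData

/-- The condition number `‖M‖₂ ‖M⁻¹‖₂` of an invertible matrix, for the norms induced by the
Euclidean norm. -/
def cond₂ {ι : Type*} [Fintype ι] [DecidableEq ι] (M : Matrix ι ι ℝ) : ℝ :=
  ‖Matrix.toEuclideanCLM (𝕜 := ℝ) M‖ * ‖Matrix.toEuclideanCLM (𝕜 := ℝ) M⁻¹‖

end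

/-! Everything rests on one explicit test element. Let `r ∈ V_h` be the Riesz representative of
`a_∥(q,·)` for the inner product `a` on `V_h`, so that `|r|_𝒱 = |q|_{*h}` and `a_∥(q,r) =
|q|_{*h}²`. Testing `(u,q)` with `(u + κ r, -(1+ε) q)` gives `|u|_𝒱² + κ a_∥(q,u) + (1-ε) κ
|q|_{*h}² - 2 ε a_∥(q,u) + (1+ε) ε |q|_∥²`. Since `a_∥ ≤ a`, Cauchy-Schwarz makes the terms without
`κ` coercive in `|u|_𝒱² + ε |q|_∥²`. For `ε ≤ 1/2` a small `κ > 0` adds control of `|q|_{*h}²`; for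
`ε ≥ 1/2` one takes `κ = 0`, because `|q|_{*h} ≤ |q|_∥`. The constants are numerical functions of
`ε`, so no Poincaré, mesh or ellipticity constant enters `β` (`test_lower`, `test_bound`,
`exists_test`).

The geometry enters only through definiteness. On `V_h`, `a(u,u) = 0` makes the continuous piecewise
polynomial `u` constant, hence zero by its trace on `Γ_D`; this gives `r`. On `L_h`, `a_∥(q,q) = 0`
makes `q` constant along field lines, hence zero by its trace on `Γ_in`. As `L_h ⊆ V_h`, a vanishing
`|q|_{*h}` allows the test `v = q`, so `|·|_{*h}` is a norm on `L_h` and the estimates survive at `ε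
= 0`.

In finite dimension the inf-sup bound gives injectivity, thus well-posedness, and the a priori
bound. The difference `U_ε - U_0` solves the problem for `C_ε` with a right-hand side of size
`O(ε)`. The matrix is affine in `ε` and invertible on the compact interval, so its condition number
is bounded there. -/

noncomputable section

/-! ### Boundary points and traces -/

/-- Near `x` the boundary is a Lipschitz graph over the hyperplane `e^⊥`. The orthogonal projection
onto it is 1-Lipschitz and maps the boundary piece onto a set containing a neighbourhood in a
`(d-1)`-dimensional space, so the piece cannot be null. -/
theorem hausdorffMeasure_frontier_inter_pos {d : ℕ} (hd : 1 ≤ d) {Ω : Set (Euc d)}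
    (hΩ : IsOpen Ω) (hL : HasLipschitzBoundary Ω) {x : Euc d} (hx : x ∈ frontier Ω)
    {U : Set (Euc d)} (hU : U ∈ 𝓝 x) :
    0 < (Measure.hausdorffMeasure ((d : ℝ) - 1) : Measure (Euc d)) (frontier Ω ∩ U) := by
  obtain ⟨n, rfl⟩ : ∃ n, d = n + 1 := ⟨d - 1, by omega⟩
  obtain ⟨e, K, ψ, he, hψ, hev⟩ := hL x hx
  have he0 : e ≠ 0 := by
    rintro rfl
    simp at he
  have hee : (inner ℝ e e : ℝ) = 1 := by rw [real_inner_self_eq_norm_sq, he, one_pow]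
  set φ : Euc (n + 1) → ℝ := fun y => inner ℝ y e - ψ (y - (inner ℝ y e : ℝ) • e) with hφdef
  have hφc : Continuous φ := by
    have := hψ.continuous
    fun_prop
  have hevφ : ∀ᶠ y in 𝓝 x, (y ∈ Ω ↔ φ y < 0) := by
    filter_upwards [hev] with y hy
    rw [hy, hφdef]
    exact sub_neg.symm
  have hxΩ : x ∉ Ω := fun h => (hΩ.frontier_eq ▸ hx).2 h
  have hφx : φ x = 0 := by
    refine le_antisymm ?_ (not_lt.1 fun h => hxΩ (hevφ.self_of_nhds.2 h))
    by_contra! hpos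
    have h1 : ∀ᶠ y in 𝓝 x, y ∉ Ω := by
      filter_upwards [hevφ, hφc.continuousAt.eventually (lt_mem_nhds hpos)] with y hy hy' hyΩ
      exact lt_asymm (hy.1 hyΩ) hy'
    exact mem_closure_iff_frequently.1 (frontier_subset_closure hx) h1
  set F : Submodule ℝ (Euc (n + 1)) := (ℝ ∙ e)ᗮ with hF
  have hFe : ∀ z : F, (inner ℝ (z : Euc (n + 1)) e : ℝ) = 0 := fun z =>
    Submodule.mem_orthogonal_singleton_iff_inner_left.1 z.2
  have hfin : (Module.finrank ℝ F : ℝ) = ((n + 1 : ℕ) : ℝ) - 1 := by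
    have : Fact (Module.finrank ℝ (Euc (n + 1)) = n + 1) := ⟨by simp⟩
    rw [hF, Submodule.finrank_orthogonal_span_singleton (n := n) he0]
    simp
  set σ : F → Euc (n + 1) := fun z => z + ψ z • e with hσ
  have hσc : Continuous σ := by
    have := hψ.continuous
    fun_prop
  have hσe : ∀ z : F, (inner ℝ (σ z) e : ℝ) = ψ z := fun z => by
    rw [hσ]
    simp only [inner_add_left, real_inner_smul_left, hFe z, hee, zero_add, mul_one]
  have hφσ : ∀ (z : F) (t : ℝ), φ (σ z - t • e) = -t := fun z t => by
    have h1 : (inner ℝ (σ z - t • e) e : ℝ) = ψ z - t := by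
      rw [inner_sub_left, real_inner_smul_left, hσe, hee, mul_one]
    have h2 : σ z - t • e - (ψ z - t) • e = z := by
      simp only [hσ, sub_smul]
      abel
    simp only [hφdef, h1, h2]
    ring
  let z₀ : F := ⟨x - (inner ℝ x e : ℝ) • e, by
    rw [hF, Submodule.mem_orthogonal_singleton_iff_inner_left, inner_sub_left,
      real_inner_smul_left, hee, mul_one, sub_self]⟩
  have hz₀ : σ z₀ = x := by
    have h1 : (inner ℝ x e : ℝ) = ψ (x - (inner ℝ x e : ℝ) • e) := sub_eq_zero.1 hφx
    change x - (inner ℝ x e : ℝ) • e + ψ (x - (inner ℝ x e : ℝ) • e) • e = x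
    rw [← h1, sub_add_cancel]
  have hN : ∀ᶠ z in 𝓝 z₀, σ z ∈ U ∧ ∀ᶠ y in 𝓝 (σ z), (y ∈ Ω ↔ φ y < 0) := by
    have h1 : ∀ᶠ y in 𝓝 (σ z₀), y ∈ U ∧ ∀ᶠ y' in 𝓝 y, (y' ∈ Ω ↔ φ y' < 0) := by
      rw [hz₀]
      exact Filter.Eventually.and hU (eventually_eventually_nhds.2 hevφ)
    exact hσc.continuousAt.eventually h1
  have hsub : {z : F | σ z ∈ U ∧ ∀ᶠ y in 𝓝 (σ z), (y ∈ Ω ↔ φ y < 0)} ⊆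
      F.orthogonalProjectionOnto '' (frontier Ω ∩ U) := by
    rintro z ⟨hzU, hz⟩
    refine ⟨σ z, ⟨?_, hzU⟩, ?_⟩
    · rw [hΩ.frontier_eq]
      refine ⟨?_, fun h => ?_⟩
      -- The graph point is approached from inside `Ω` by sliding down along `-e`, where `φ = -t <
      -- 0`.
      · have ht : Tendsto (fun t : ℝ => σ z - t • e) (𝓝[>] 0) (𝓝 (σ z)) := by
          have : Continuous fun t : ℝ => σ z - t • e := by fun_prop
          simpa using (this.tendsto 0).mono_left nhdsWithin_le_nhds
        refine mem_closure_of_tendsto ht ?_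
        filter_upwards [ht.eventually hz, self_mem_nhdsWithin] with t h1 h2
        rw [h1, hφσ]
        exact neg_lt_zero.2 h2
      · have h1 := hz.self_of_nhds.1 h
        have h2 := hφσ z 0
        rw [zero_smul, sub_zero, neg_zero] at h2
        exact h1.ne h2
    · have h1 : F.orthogonalProjectionOnto e = 0 := by
        rw [Submodule.orthogonalProjectionOnto_eq_zero_iff]
        exact Submodule.le_orthogonal_orthogonal _ (Submodule.mem_span_singleton_self e)
      rw [hσ]
      simp [h1]
  have hpos : 0 < (Measure.hausdorffMeasure (((n + 1 : ℕ) : ℝ) - 1) : Measure F)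
      {z : F | σ z ∈ U ∧ ∀ᶠ y in 𝓝 (σ z), (y ∈ Ω ↔ φ y < 0)} := by
    rw [← hfin]
    exact Measure.measure_pos_of_mem_nhds _ hN
  have hle := F.lipschitzWith_orthogonalProjectionOnto.hausdorffMeasure_image_le
    (d := ((n + 1 : ℕ) : ℝ) - 1) (by simp) (frontier Ω ∩ U)
  rw [ENNReal.coe_one, ENNReal.one_rpow, one_mul] at hle
  exact hpos.trans_le ((measure_mono hsub).trans hle)

theorem tendsto_average_abs_of_continuousOn {d : ℕ} {Ω : Set (Euc d)} (hΩ : IsOpen Ω)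
    {v : L2 Ω ℝ} {w : Euc d → ℝ} (hw : ContinuousOn w (closure Ω))
    (hv : v =ᵐ[volume.restrict Ω] w) {x : Euc d} (hx : x ∈ closure Ω) :
    Tendsto (fun r : ℝ => ⨍ y in Metric.ball x r ∩ Ω, |v y|) (𝓝[>] 0) (𝓝 |w x|) := by
  rw [Metric.tendsto_nhdsWithin_nhds]
  intro ε hε
  obtain ⟨δ, hδ, h⟩ := Metric.continuousOn_iff.1 hw x hx (ε / 2) (half_pos hε)
  refine ⟨δ, hδ, fun r hr hrδ => ?_⟩
  rw [Real.dist_eq, sub_zero, abs_of_pos hr] at hrδ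
  -- A mean of values lying in a closed ball lies in that ball, by convexity.
  have hmem : (⨍ y in Metric.ball x r ∩ Ω, |v y|) ∈ Metric.closedBall |w x| (ε / 2) := by
    refine (convex_closedBall _ _).set_average_mem Metric.isClosed_closedBall ?_ ?_ ?_
      (v.integrableOn_ball_inter x r)
    · refine ((Metric.isOpen_ball.inter hΩ).measure_pos _ ?_).ne'
      exact mem_closure_iff.1 hx _ Metric.isOpen_ball (Metric.mem_ball_self hr)
    · exact ((measure_mono inter_subset_left).trans_lt measure_ball_lt_top).ne
    · filter_upwards [L2.ae_ball_inter hv x r,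
        ae_restrict_mem (Metric.isOpen_ball.inter hΩ).measurableSet] with y hy hyr
      have h1 := h y (subset_closure hyr.2) ((Metric.mem_ball.1 hyr.1).trans hrδ)
      rw [Metric.mem_closedBall, Real.dist_eq, hy]
      rw [Real.dist_eq] at h1
      exact (abs_abs_sub_abs_le_abs_sub _ _).trans h1.le
  exact (Metric.mem_closedBall.1 hmem).trans_lt (half_lt_self hε)

/-- For a function continuous up to the boundary the means converge to `|w|`. If `w x ≠ 0`, then `w
≠ 0` on a relative neighbourhood of `x` in the boundary, which has positive surface measure, against
the almost everywhere vanishing of the trace. -/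
theorem TraceZeroOn.eq_zero_of_continuousOn {d : ℕ} (hd : 1 ≤ d) {Ω S : Set (Euc d)}
    (hΩ : IsOpen Ω) (hL : HasLipschitzBoundary Ω) {v : L2 Ω ℝ} {w : Euc d → ℝ}
    (hw : ContinuousOn w (closure Ω)) (hv : v =ᵐ[volume.restrict Ω] w) (hT : TraceZeroOn Ω S v)
    {x : Euc d} (hx : x ∈ frontier Ω) (hS : ∀ᶠ y in 𝓝[frontier Ω] x, y ∈ S) : w x = 0 := by
  by_contra hne
  have h1 : ∀ᶠ y in 𝓝[frontier Ω] x, w y ≠ 0 :=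
    ((hw x (frontier_subset_closure hx)).mono frontier_subset_closure).eventually
      (isOpen_ne.mem_nhds hne)
  obtain ⟨U, hU, hUs⟩ := mem_nhdsWithin_iff_exists_mem_nhds_inter.1 (h1.and hS)
  refine (hausdorffMeasure_frontier_inter_pos hd hΩ hL hx hU).ne' ?_
  refine measure_mono_null (fun y hy => ?_) (ae_iff.1 hT)
  obtain ⟨h2, h3⟩ := hUs ⟨hy.2, hy.1⟩
  intro h4
  have h5 := tendsto_nhds_unique (h4 h3)
    (tendsto_average_abs_of_continuousOn hΩ hw hv (frontier_subset_closure hy.1))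
  exact h2 (abs_eq_zero.1 h5.symm)

theorem ContDiffAt.continuousAt_gradient {d : ℕ} {ρ : Euc d → ℝ} {x : Euc d}
    (h : ContDiffAt ℝ 1 ρ x) : ContinuousAt (gradient ρ) x :=
  (InnerProductSpace.toDual ℝ (Euc d)).symm.continuous.continuousAt.comp
    (h.continuousAt_fderiv one_ne_zero)

/-- `Γ_in` is relatively open: `b` is continuous up to the boundary and `∇ρ` is continuous near `x`,
so the strict sign of `b · ∇ρ` persists, and the same `ρ` defines the normals nearby. -/
theorem AnisotropicData.eventually_mem_Γin {d : ℕ} {D : AnisotropicData d}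
    (hb : ContinuousOn D.b (closure D.Ω)) {x : Euc d} (hx : x ∈ D.Γin) :
    ∀ᶠ y in 𝓝[frontier D.Ω] x, y ∈ D.Γin := by
  obtain ⟨n, ⟨hxf, hn, ρ, hρ, hΩρ, c, hc, hgrad⟩, hbn⟩ := hx
  have hgc := hρ.continuousAt_gradient
  have hg0 : gradient ρ x ≠ 0 := by
    rw [hgrad]
    refine smul_ne_zero hc.ne' ?_
    rintro rfl
    simp at hn
  have h1 : ∀ᶠ y in 𝓝[frontier D.Ω] x, (inner ℝ (D.b y) (gradient ρ y) : ℝ) < 0 := by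
    have hbc : ContinuousWithinAt D.b (frontier D.Ω) x :=
      (hb x (frontier_subset_closure hxf)).mono frontier_subset_closure
    have := hbc.inner (𝕜 := ℝ) hgc.continuousWithinAt
    refine this.eventually (gt_mem_nhds ?_)
    simp only [hgrad, real_inner_smul_right]
    exact mul_neg_of_pos_of_neg hc hbn
  filter_upwards [h1, self_mem_nhdsWithin,
    (hgc.eventually (isOpen_ne.mem_nhds hg0)).filter_mono nhdsWithin_le_nhds,
    (hρ.eventually (by simp)).filter_mono nhdsWithin_le_nhds,
    (eventually_eventually_nhds.2 hΩρ).filter_mono nhdsWithin_le_nhds] with y h1 h2 h3 h4 h5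
  have h6 : 0 < ‖gradient ρ y‖ := norm_pos_iff.2 h3
  refine ⟨‖gradient ρ y‖⁻¹ • gradient ρ y, ⟨h2, ?_, ρ, h4, h5, ‖gradient ρ y‖, h6, ?_⟩, ?_⟩
  · rw [norm_smul, norm_inv, norm_norm, inv_mul_cancel₀ h6.ne']
  · rw [smul_inv_smul₀ h6.ne']
  · rw [real_inner_smul_right]
    exact mul_neg_of_pos_of_neg (inv_pos.2 h6) h1

/-! ### Cells and piecewise polynomials -/

theorem contDiff_eval_mvPolynomial {d : ℕ} (p : MvPolynomial (Fin d) ℝ) :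
    ContDiff ℝ ∞ fun x : Euc d => MvPolynomial.eval (⇑x) p := by
  induction p using MvPolynomial.induction_on with
  | C a => simpa using contDiff_const
  | add p q hp hq => simpa using hp.add hq
  | mul_X p i hp =>
    simp only [map_mul, MvPolynomial.eval_X]
    exact hp.mul (EuclideanSpace.proj (𝕜 := ℝ) i).contDiff

theorem CellShape.convex_refCell (d : ℕ) (s : CellShape) : Convex ℝ (s.refCell d) := by
  cases s
  · intro x hx y hy a b ha hb hab
    refine ⟨fun i => ?_, ?_⟩
    · have := hx.1 i
      have := hy.1 i
      simp only [PiLp.add_apply, PiLp.smul_apply, smul_eq_mul]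
      positivity
    · simp only [PiLp.add_apply, PiLp.smul_apply, smul_eq_mul, Finset.sum_add_distrib,
        ← Finset.mul_sum]
      nlinarith [mul_le_mul_of_nonneg_left hx.2 ha, mul_le_mul_of_nonneg_left hy.2 hb]
  · intro x hx y hy a b ha hb hab i
    simp only [PiLp.add_apply, PiLp.smul_apply, smul_eq_mul]
    have h1 := hx i
    have h2 := hy i
    constructor
    · exact add_nonneg (mul_nonneg ha h1.1) (mul_nonneg hb h2.1)
    · nlinarith [mul_le_mul_of_nonneg_left h1.2 ha, mul_le_mul_of_nonneg_left h2.2 hb]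

theorem CellShape.isClosed_refCell (d : ℕ) (s : CellShape) : IsClosed (s.refCell d) := by
  cases s
  · simp only [refCell, ofPred_and, ofPred_forall]
    exact (isClosed_iInter fun i => isClosed_le (by fun_prop) (by fun_prop)).inter
      (isClosed_le (by fun_prop) (by fun_prop))
  · simp only [refCell, ofPred_and, ofPred_forall]
    exact isClosed_iInter fun i => (isClosed_le (by fun_prop) (by fun_prop)).inter
      (isClosed_le (by fun_prop) (by fun_prop))

theorem CellShape.nonempty_interior_refCell (d : ℕ) (s : CellShape) :
    (interior (s.refCell d)).Nonempty := by
  have hd : (0 : ℝ) < d + 1 := by positivity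
  -- All coordinates equal `1/(2(d+1))`: positive, less than `1`, and with sum less than `1`, so one
  -- point serves both shapes.
  refine ⟨WithLp.toLp 2 fun _ => ((d : ℝ) + 1)⁻¹ / 2, ?_⟩
  have hle : ((d : ℝ) + 1)⁻¹ ≤ 1 := inv_le_one_of_one_le₀ (by simp)
  have hpos : (0 : ℝ) < ((d : ℝ) + 1)⁻¹ := inv_pos.2 hd
  rw [mem_interior_iff_mem_nhds]
  have h0 : ∀ᶠ x : Euc d in 𝓝 (WithLp.toLp 2 fun _ => ((d : ℝ) + 1)⁻¹ / 2), ∀ i, 0 < x i :=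
    eventually_all.2 fun i => (EuclideanSpace.proj (𝕜 := ℝ) i).continuous.continuousAt.eventually
      (lt_mem_nhds (by simpa using hpos))
  cases s
  · have h1 : ∀ᶠ x : Euc d in 𝓝 (WithLp.toLp 2 fun _ => ((d : ℝ) + 1)⁻¹ / 2), ∑ i, x i < 1 := by
      have hc : Continuous fun x : Euc d => ∑ i, x i := by fun_prop
      refine hc.continuousAt.eventually (gt_mem_nhds ?_)
      simp only [Finset.sum_const, Finset.card_univ, Fintype.card_fin, nsmul_eq_mul]
      have : (d + 1 : ℝ) * (d + 1 : ℝ)⁻¹ = 1 := mul_inv_cancel₀ hd.ne'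
      nlinarith
    filter_upwards [h0, h1] with x hx hx'
    exact ⟨fun i => (hx i).le, hx'.le⟩
  · have h1 : ∀ᶠ x : Euc d in 𝓝 (WithLp.toLp 2 fun _ => ((d : ℝ) + 1)⁻¹ / 2), ∀ i, x i < 1 :=
      eventually_all.2 fun i =>
        (EuclideanSpace.proj (𝕜 := ℝ) i).continuous.continuousAt.eventually
          (gt_mem_nhds (by simp; linarith))
    filter_upwards [h0, h1] with x hx hx' i
    exact ⟨(hx i).le, (hx' i).le⟩

namespace FEMesh

variable {d : ℕ} {Ω : Set (Euc d)} {s : CellShape} {h : ℝ} (T : FEMesh Ω s h)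

/-- The cells of a mesh. -/
def cell (i : Fin T.numCells) : Set (Euc d) := T.map i '' s.refCell d

theorem isClosed_cell (i : Fin T.numCells) : IsClosed (T.cell i) :=
  (AffineEquiv.toContinuousAffineEquiv (T.map i)).toHomeomorph.isClosedMap _
    (s.isClosed_refCell d)

/-- A convex set with nonempty interior has the same closure as its interior. This carries almost
everywhere identities inside a cell to its faces. -/
theorem cell_subset_closure_interior (i : Fin T.numCells) :
    T.cell i ⊆ closure (interior (T.cell i)) := by
  have h1 := (AffineEquiv.toContinuousAffineEquiv (T.map i)).toHomeomorph.image_interior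
    (s.refCell d)
  have hne : (interior (T.cell i)).Nonempty := by
    rw [cell, ← AffineEquiv.coe_toContinuousAffineEquiv]
    exact h1 ▸ (s.nonempty_interior_refCell d).image _
  have hcv : Convex ℝ (T.cell i) := (s.convex_refCell d).affine_image (T.map i).toAffineMap
  rw [hcv.closure_interior_eq_closure_of_nonempty_interior hne]
  exact subset_closure

theorem exists_mem_cell {x : Euc d} (hx : x ∈ closure Ω) : ∃ i, x ∈ T.cell i := by
  rw [← T.cover] at hx
  exact mem_iUnion.1 hx

/-- There are finitely many closed cells, so those missing `x` also miss a neighbourhood of `x`; any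
cell containing a nearby point then contains `x`. -/
theorem eventually_exists_common_cell {x : Euc d} (hΩ : IsOpen Ω) (hx : x ∈ Ω) :
    ∀ᶠ y in 𝓝 x, ∃ i, x ∈ T.cell i ∧ y ∈ T.cell i := by
  have h1 : ∀ᶠ y in 𝓝 x, ∀ i, x ∉ T.cell i → y ∉ T.cell i :=
    eventually_all.2 fun i => by
      by_cases hi : x ∈ T.cell i
      · simp [hi]
      · filter_upwards [(T.isClosed_cell i).isOpen_compl.mem_nhds hi] with y hy _ using hy
  filter_upwards [h1, hΩ.mem_nhds hx] with y hy hyΩ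
  obtain ⟨i, hi⟩ := T.exists_mem_cell (subset_closure hyΩ)
  exact ⟨i, not_not.1 fun hxi => hy i hxi hi, hi⟩

/-- A continuous function vanishing almost everywhere inside a cell vanishes on the cell. -/
theorem eq_zero_on_cell {F : Type*} [NormedAddCommGroup F] (hΩ : IsOpen Ω) {f : Euc d → F}
    (hf : ContinuousOn f Ω) {i : Fin T.numCells}
    (h0 : ∀ᵐ x ∂volume.restrict (interior (T.cell i) ∩ Ω), f x = 0) {x : Euc d}
    (hx : x ∈ T.cell i) (hxΩ : x ∈ Ω) : f x = 0 := by
  have h1 : EqOn f 0 (interior (T.cell i) ∩ Ω) :=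
    Measure.eqOn_open_of_ae_eq h0 (isOpen_interior.inter hΩ) (hf.mono inter_subset_right)
      continuousOn_const
  have h2 : EqOn f 0 (closure (interior (T.cell i)) ∩ Ω) :=
    h1.of_subset_closure (hf.mono inter_subset_right) continuousOn_const
      (inter_subset_inter_left _ subset_closure) hΩ.closure_inter
  exact h2 ⟨T.cell_subset_closure_interior i hx, hxΩ⟩

/-- Pulled back by the inverse affine map, the polynomial is smooth on all of space, so each piece
can be differentiated even at the faces of its cell. -/
theorem IsPiecewisePoly.exists_contDiff {T : FEMesh Ω s h} {k : ℕ} {w : Euc d → ℝ}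
    (hw : T.IsPiecewisePoly k w) (i : Fin T.numCells) :
    ∃ P : Euc d → ℝ, ContDiff ℝ ∞ P ∧ EqOn w P (T.cell i) := by
  obtain ⟨p, -, hp⟩ := hw.2 i
  refine ⟨fun y => MvPolynomial.eval (⇑((T.map i).symm y)) p, ?_, ?_⟩
  · exact (contDiff_eval_mvPolynomial p).comp
      (AffineEquiv.toContinuousAffineEquiv (T.map i).symm).toContinuousAffineMap.contDiff
  · rintro _ ⟨x, hx, rfl⟩
    simp [hp x hx]

end FEMesh

/-! ### Weak gradients -/

theorem L2.locallyIntegrableOn {d : ℕ} {Ω O : Set (Euc d)} {F : Type} [NormedAddCommGroup F]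
    (hOΩ : O ⊆ Ω) (g : L2 Ω F) : LocallyIntegrableOn g O := by
  have h1 : LocallyIntegrable g (volume.restrict O) :=
    ((Lp.memLp g).mono_measure (Measure.restrict_mono hOΩ le_rfl)).locallyIntegrable (by norm_num)
  exact locallyIntegrableOn_of_locallyIntegrable_restrict h1

/-- Where the function is smooth, the weak gradient is the gradient. -/
theorem IsWeakGradient.ae_eq_gradient {d : ℕ} {Ω O : Set (Euc d)} {u : L2 Ω ℝ} {g : L2 Ω (Euc d)}
    (hg : IsWeakGradient Ω u g) (hΩ : IsOpen Ω) (hO : IsOpen O) (hOΩ : O ⊆ Ω) {P : Euc d → ℝ}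
    (hP : ContDiff ℝ ∞ P) (huP : u =ᵐ[volume.restrict O] P) :
    g =ᵐ[volume.restrict O] gradient P := by
  have hPc : Continuous (gradient P) :=
    (InnerProductSpace.toDual ℝ (Euc d)).symm.continuous.comp (hP.continuous_fderiv (by simp))
  have hloc := g.locallyIntegrableOn hOΩ
  have hlocP : LocallyIntegrableOn (gradient P) O := hPc.locallyIntegrable.locallyIntegrableOn O
  have key : ∀ᵐ x ∂(volume : Measure (Euc d)), x ∈ O → (g x - gradient P x) = 0 := by
    -- Fundamental lemma of the calculus of variations: it suffices that `g - ∇P` integrates to zero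
    -- against every test function supported in `O`.
    refine hO.ae_eq_zero_of_integral_contDiff_smul_eq_zero (hloc.sub hlocP) fun φ h1 h2 h3 => ?_
    have hφ : IsTestFun O φ := ⟨h1, h2, h3⟩
    have hφΩ : IsTestFun Ω φ := ⟨h1, h2, h3.trans hOΩ⟩
    have hφ0 : ∀ x ∉ O, φ x = 0 := fun x hx => image_eq_zero_of_notMem_tsupport fun h => hx (h3 h)
    have hdφ0 : ∀ x ∉ O, fderiv ℝ φ x = 0 := fun x hx => by
      by_contra h
      exact hx (h3 (support_fderiv_subset ℝ h))
    have hdφc : ∀ e, Continuous fun x => fderiv ℝ φ x e := fun e =>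
      (h1.continuous_fderiv (by simp)).clm_apply continuous_const
    have hdPc : ∀ e, Continuous fun x => fderiv ℝ P x e := fun e =>
      (hP.continuous_fderiv (by simp)).clm_apply continuous_const
    have i1 : IntegrableOn (fun x => φ x • g x) O := by
      have : MemLp g 2 (volume.restrict O) :=
        (Lp.memLp g).mono_measure (Measure.restrict_mono hOΩ le_rfl)
      exact (memLp_one_iff_integrable.1 (this.smul hφ.memLp))
    have i2 : IntegrableOn (fun x => φ x • gradient P x) O :=
      ((h1.continuous.smul hPc).integrable_of_hasCompactSupport h2.smul_right).integrableOn
    rw [← setIntegral_eq_integral_of_forall_compl_eq_zero (s := O)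
      fun x hx => by rw [hφ0 x hx, zero_smul]]
    have i3 : IntegrableOn (fun x => φ x • (g x - gradient P x)) O := by
      exact (i1.sub i2).congr (Eventually.of_forall fun x => by simp [smul_sub])
    refine ext_inner_left ℝ fun e => ?_
    rw [inner_zero_right, ← integral_inner i3]
    have e1 : ∀ x, (inner ℝ e (φ x • (g x - gradient P x)) : ℝ)
        = (inner ℝ (g x) e : ℝ) * φ x - fderiv ℝ P x e * φ x := fun x => by
      have : (inner ℝ e (gradient P x) : ℝ) = fderiv ℝ P x e := by
        rw [real_inner_comm, gradient, InnerProductSpace.toDual_symm_apply]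
      rw [real_inner_smul_right, inner_sub_right, this, real_inner_comm]
      ring
    simp only [e1]
    have i4 : IntegrableOn (fun x => (inner ℝ (g x) e : ℝ) * φ x) O := by
      refine (i1.inner_const e).congr (Eventually.of_forall fun x => ?_)
      simp only [real_inner_smul_left]
      ring
    have i5 : Integrable (fun x => fderiv ℝ P x e * φ x) volume :=
      ((hdPc e).mul h1.continuous).integrable_of_hasCompactSupport h2.mul_left
    have hdφs : HasCompactSupport fun x => fderiv ℝ φ x e := h2.fderiv_apply (𝕜 := ℝ) e
    rw [integral_sub i4 i5.integrableOn]
    have e2 : ∫ x in O, (inner ℝ (g x) e : ℝ) * φ x = ∫ x in Ω, (inner ℝ (g x) e : ℝ) * φ x :=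
      (setIntegral_eq_of_subset_of_forall_sdiff_eq_zero hΩ.measurableSet hOΩ fun x hx => by
        rw [hφ0 x hx.2, mul_zero]).symm
    have e3 : ∫ x in Ω, u x * fderiv ℝ φ x e = ∫ x in O, u x * fderiv ℝ φ x e :=
      setIntegral_eq_of_subset_of_forall_sdiff_eq_zero hΩ.measurableSet hOΩ fun x hx => by
        rw [hdφ0 x hx.2]; simp
    have e4 : ∫ x in O, u x * fderiv ℝ φ x e = ∫ x in O, P x * fderiv ℝ φ x e := by
      refine integral_congr_ae ?_
      filter_upwards [huP] with x hx
      rw [hx]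
    have e5 : ∫ x in O, P x * fderiv ℝ φ x e = ∫ x, P x * fderiv ℝ φ x e :=
      setIntegral_eq_integral_of_forall_compl_eq_zero fun x hx => by rw [hdφ0 x hx]; simp
    have e6 : ∫ x in O, fderiv ℝ P x e * φ x = ∫ x, fderiv ℝ P x e * φ x :=
      setIntegral_eq_integral_of_forall_compl_eq_zero fun x hx => by rw [hφ0 x hx]; simp
    -- Integration by parts on the whole space, with no boundary term since `φ` has compact support.
    have e7 := integral_mul_fderiv_eq_neg_fderiv_mul_of_integrable (v := e) i5
      ((hP.continuous.mul (hdφc e)).integrable_of_hasCompactSupport hdφs.mul_left)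
      ((hP.continuous.mul h1.continuous).integrable_of_hasCompactSupport h2.mul_left)
      (fun x _ => (hP.differentiable (by simp)) x) (fun x _ => (h1.differentiable (by simp)) x)
    have e8 := hg φ hφΩ e
    linarith
  rw [EventuallyEq, ae_restrict_iff' hO.measurableSet]
  filter_upwards [key] with x hx hxO
  exact sub_eq_zero.1 (hx hxO)

/-- A function made of finitely many pieces has derivative zero at a point if the pieces
occurring near that point agree with the function and have derivative zero there. -/
theorem hasFDerivAt_zero_of_pieces {E ι : Type*} [NormedAddCommGroup E] [NormedSpace ℝ E]
    [Finite ι] {f : E → ℝ} {P : ι → E → ℝ} {x : E}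
    (h : ∀ᶠ y in 𝓝 x, ∃ i, HasFDerivAt (P i) (0 : E →L[ℝ] ℝ) x ∧ f x = P i x ∧ f y = P i y) :
    HasFDerivAt f (0 : E →L[ℝ] ℝ) x := by
  rw [hasFDerivAt_iff_isLittleO, Asymptotics.isLittleO_iff]
  intro c hc
  have h1 : ∀ᶠ y in 𝓝 x, ∀ i, HasFDerivAt (P i) (0 : E →L[ℝ] ℝ) x →
      ‖P i y - P i x - (0 : E →L[ℝ] ℝ) (y - x)‖ ≤ c * ‖y - x‖ :=
    eventually_all.2 fun i => by
      by_cases hi : HasFDerivAt (P i) (0 : E →L[ℝ] ℝ) x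
      · filter_upwards [(Asymptotics.isLittleO_iff.1 (hasFDerivAt_iff_isLittleO.1 hi)) hc]
          with y hy _ using hy
      · simp [hi]
  filter_upwards [h, h1] with y ⟨i, hi, hx, hy⟩ h2
  rw [hx, hy]
  exact h2 i hi

/-! ### Kernels of the two energies and dimension of the finite element space -/

theorem fderiv_apply_eq_inner_gradient {d : ℕ} (P : Euc d → ℝ) (x e : Euc d) :
    fderiv ℝ P x e = inner ℝ e (gradient P x) := by
  rw [real_inner_comm, gradient, InnerProductSpace.toDual_symm_apply]

instance finiteDimensional_refPoly (d k : ℕ) (s : CellShape) :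
    FiniteDimensional ℝ (s.refPoly d k) := by
  have hfin : {n : Fin d →₀ ℕ | ∀ i, n i ≤ k}.Finite := by
    refine (Set.finite_Iic (Finsupp.equivFunOnFinite.symm fun _ => k)).subset fun n hn i => ?_
    exact hn i
  cases s
  · have : Finite {n : Fin d →₀ ℕ | (n.sum fun _ e => e) ≤ k} := by
      refine (hfin.subset fun n hn i => ?_).to_subtype
      by_cases hi : n i = 0
      · simp [hi]
      · exact (Finset.single_le_sum (f := fun i => n i) (fun _ _ => Nat.zero_le _)
          (Finsupp.mem_support_iff.2 hi)).trans hn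
    exact Module.Finite.of_basis (MvPolynomial.basisRestrictSupport ℝ _)
  · have : Finite {n : Fin d →₀ ℕ | ∀ i, n i ≤ k} := hfin.to_subtype
    exact Module.Finite.of_basis (MvPolynomial.basisRestrictSupport ℝ _)

namespace AnisotropicData

variable {d : ℕ} {D : AnisotropicData d}

/-- The gradient component carries no extra freedom: the weak gradient of the zero function is zero.
-/
theorem eq_zero_of_val_eq_zero {u : D.V} (hu : val u = 0) : u = 0 := by
  have h0 : val u =ᵐ[volume.restrict D.Ω] fun _ => (0 : ℝ) := by
    rw [hu]
    exact Lp.coeFn_zero ℝ 2 (volume.restrict D.Ω)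
  have hg : IsWeakGradient D.Ω (val u) (grad u) := u.2.1
  have h1 := hg.ae_eq_gradient D.isOpen D.isOpen subset_rfl contDiff_const h0
  refine Subtype.ext (Prod.ext hu ?_)
  refine Lp.ext (h1.trans ?_)
  filter_upwards [Lp.coeFn_zero (Euc d) 2 (volume.restrict D.Ω)] with x hx
  change _ = (0 : L2 D.Ω (Euc d)) x
  rw [hx, Pi.zero_apply]
  simp [gradient]

variable {s : CellShape} {h : ℝ} {T : FEMesh D.Ω s h} {k : ℕ}

theorem exists_pieces_of_mem_Vh {u : D.V} (hu : u ∈ D.Vh T k) :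
    ∃ w : Euc d → ℝ, ContinuousOn w (closure D.Ω) ∧ val u =ᵐ[volume.restrict D.Ω] w ∧
      ∃ P : Fin T.numCells → Euc d → ℝ, ∀ i, ContDiff ℝ ∞ (P i) ∧ EqOn w (P i) (T.cell i) ∧
        grad u =ᵐ[volume.restrict (interior (T.cell i) ∩ D.Ω)] gradient (P i) := by
  obtain ⟨w, hw, huw⟩ := hu
  choose P hP hwP using hw.exists_contDiff
  have hg : IsWeakGradient D.Ω (val u) (grad u) := u.2.1
  refine ⟨w, hw.1, huw, P, fun i => ⟨hP i, hwP i, ?_⟩⟩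
  have hO : IsOpen (interior (T.cell i) ∩ D.Ω) := isOpen_interior.inter D.isOpen
  refine hg.ae_eq_gradient D.isOpen hO inter_subset_right (hP i) ?_
  filter_upwards [ae_mono (Measure.restrict_mono inter_subset_right le_rfl) huw,
    ae_restrict_mem hO.measurableSet] with x hx hxi
  rw [hx, hwP i (interior_subset hxi.1)]

theorem eq_zero_of_ae_eq_zero {u : D.V} {w : Euc d → ℝ} (huw : val u =ᵐ[volume.restrict D.Ω] w)
    (hw : ∀ᵐ x ∂volume.restrict D.Ω, w x = 0) : u = 0 := by
  refine eq_zero_of_val_eq_zero (Lp.ext ((huw.trans hw).trans ?_))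
  exact (Lp.coeFn_zero ℝ 2 (volume.restrict D.Ω)).symm

/-- Definiteness of `a` on `V_h`. Each polynomial piece has zero gradient on its cell within `Ω`, so
the glued function is differentiable with derivative zero. It is constant by connectedness, and the
constant is read off at an interior point of `Γ_D`. -/
theorem Admissible.eq_zero_of_grad_eq_zero (hD : D.Admissible) (hd : 1 ≤ d) {u : D.V}
    (hu : u ∈ D.Vh T k) (h0 : ∀ᵐ x ∂volume.restrict D.Ω, grad u x = 0) : u = 0 := by
  obtain ⟨w, hwc, huw, P, hP⟩ := exists_pieces_of_mem_Vh hu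
  have hPd : ∀ i, ∀ x ∈ T.cell i, x ∈ D.Ω → HasFDerivAt (P i) (0 : Euc d →L[ℝ] ℝ) x := by
    intro i x hxi hx
    have hgc : Continuous (gradient (P i)) :=
      (InnerProductSpace.toDual ℝ (Euc d)).symm.continuous.comp
        ((hP i).1.continuous_fderiv (by simp))
    have h1 : gradient (P i) x = 0 := by
      refine T.eq_zero_on_cell D.isOpen hgc.continuousOn ?_ hxi hx
      filter_upwards [(hP i).2.2,
        ae_mono (Measure.restrict_mono inter_subset_right le_rfl) h0] with y hy hy'
      rw [← hy, hy']
    have h2 : fderiv ℝ (P i) x = 0 := by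
      ext e
      rw [fderiv_apply_eq_inner_gradient, h1, inner_zero_right, zero_apply]
    exact h2 ▸ ((hP i).1.differentiable (by simp) x).hasFDerivAt
  have hwd : ∀ x ∈ D.Ω, HasFDerivAt w (0 : Euc d →L[ℝ] ℝ) x := by
    intro x hx
    refine hasFDerivAt_zero_of_pieces (P := P) ?_
    filter_upwards [T.eventually_exists_common_cell D.isOpen hx] with y ⟨i, hxi, hyi⟩
    exact ⟨i, hPd i x hxi hx, (hP i).2.1 hxi, (hP i).2.1 hyi⟩
  obtain ⟨c, hc⟩ := D.isOpen.exists_is_const_of_fderiv_eq_zero hD.isConnected.isPreconnected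
    (fun x hx => (hwd x hx).differentiableAt.differentiableWithinAt)
    (fun x hx => (hwd x hx).fderiv)
  have hcl : EqOn w (fun _ => c) (closure D.Ω) :=
    EqOn.of_subset_closure hc hwc continuousOn_const subset_closure subset_rfl
  obtain ⟨x₀, ⟨n, hn, -⟩, hx₀⟩ := hD.ΓD_interior
  have hT : TraceZeroOn D.Ω D.ΓD (val u) := u.2.2
  have h1 := hT.eq_zero_of_continuousOn hd D.isOpen hD.lipschitz hwc huw hn.1 hx₀
  have hc0 : c = 0 := by rw [← h1, hcl (frontier_subset_closure hn.1)]
  refine eq_zero_of_ae_eq_zero huw ?_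
  filter_upwards [ae_restrict_mem D.isOpen.measurableSet] with x hx
  rw [hc x hx, hc0]

/-- Definiteness of `a_∥` on `L_h`: the function is constant along each field line and vanishes
where the line enters, at a point of `Γ_in`. Almost every point is reached by such a line. -/
theorem Admissible.eq_zero_of_fieldDeriv_eq_zero (hD : D.Admissible) (hd : 1 ≤ d) {u : D.V}
    (hu : u ∈ D.Lh T k)
    (h0 : ∀ᵐ x ∂volume.restrict D.Ω, (inner ℝ (D.b x) (grad u x) : ℝ) = 0) : u = 0 := by
  obtain ⟨w, hwc, huw, P, hP⟩ := exists_pieces_of_mem_Vh hu.1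
  have hPd : ∀ i, ∀ x ∈ T.cell i, x ∈ D.Ω → fderiv ℝ (P i) x (D.b x) = 0 := by
    intro i x hxi hx
    refine T.eq_zero_on_cell (f := fun x => fderiv ℝ (P i) x (D.b x)) D.isOpen ?_ ?_ hxi hx
    · exact ((hP i).1.continuous_fderiv (by simp)).continuousOn.clm_apply D.b_smooth.continuousOn
    · filter_upwards [(hP i).2.2,
        ae_mono (Measure.restrict_mono inter_subset_right le_rfl) h0] with y hy hy'
      rw [fderiv_apply_eq_inner_gradient, ← hy, hy']
  have hin : ∀ x ∈ D.Γin, w x = 0 := by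
    intro x hx
    have hT : TraceZeroOn D.Ω D.Γin (val u) := hu.2.2
    obtain ⟨n, hn, -⟩ := id hx
    exact hT.eq_zero_of_continuousOn hd D.isOpen hD.lipschitz hwc huw hn.1
      (eventually_mem_Γin hD.b_continuous hx)
  refine eq_zero_of_ae_eq_zero huw ?_
  filter_upwards [hD.field_lines] with x ⟨τ, γ, hτ, hγc, hγ0, hγτ, hγΩ, hγ⟩
  have hmaps : MapsTo γ (Icc 0 τ) (closure D.Ω) := by
    intro t ht
    rcases ht.1.eq_or_lt with rfl | h1
    · obtain ⟨n, hn, -⟩ := hγ0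
      exact frontier_subset_closure hn.1
    · exact subset_closure (hγΩ t ⟨h1, ht.2⟩)
  have hder : ∀ t ∈ Ioo 0 τ, HasDerivAt (w ∘ γ) 0 t := by
    intro t ht
    have htΩ := hγΩ t ⟨ht.1, ht.2.le⟩
    -- At an interface `w` itself need not be differentiable, but every piece meeting `γ t` has zero
    -- derivative in the direction `b`, so `w ∘ γ` still has derivative zero.
    have hpd : ∀ i, γ t ∈ T.cell i → HasFDerivAt (P i ∘ γ) (0 : ℝ →L[ℝ] ℝ) t := by
      intro i hi
      have h1 := ((hP i).1.differentiable (by simp) (γ t)).hasFDerivAt.comp_hasDerivAt t (hγ t ht)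
      rw [hPd i _ hi htΩ] at h1
      simpa using h1.hasFDerivAt
    have h2 : HasFDerivAt (w ∘ γ) (0 : ℝ →L[ℝ] ℝ) t := by
      refine hasFDerivAt_zero_of_pieces (P := fun i => P i ∘ γ) ?_
      filter_upwards [(hγ t ht).continuousAt.eventually
        (T.eventually_exists_common_cell D.isOpen htΩ)] with y ⟨i, hxi, hyi⟩
      exact ⟨i, hpd i hxi, (hP i).2.1 hxi, (hP i).2.1 hyi⟩
    simpa using h2.hasDerivAt
  obtain ⟨t, -, ht⟩ := exists_hasDerivAt_eq_slope (w ∘ γ) (fun _ => 0) hτ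
    (hwc.comp hγc hmaps) hder
  have h3 := (div_eq_zero_iff.1 ht.symm).resolve_right (by simpa using hτ.ne')
  rw [Function.comp_apply, Function.comp_apply, hγτ, hin _ hγ0, sub_zero] at h3
  exact h3

/-- `R` relates a function to its tuple of cell polynomials. The tuple determines the function, so
`R` embeds in a finite-dimensional space; `R` also projects onto `V_h`. -/
instance finiteDimensional_Vh : FiniteDimensional ℝ (D.Vh T k) := by
  let R : Submodule ℝ (D.V × (Fin T.numCells → s.refPoly d k)) :=
    { carrier := {q | ∃ w : Euc d → ℝ, ContinuousOn w (closure D.Ω) ∧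
        (∀ i, ∀ x ∈ s.refCell d, w (T.map i x) = MvPolynomial.eval (⇑x) (q.2 i).1) ∧
        val q.1 =ᵐ[volume.restrict D.Ω] w}
      zero_mem' := ⟨0, continuousOn_const, by simp, Lp.coeFn_zero ℝ 2 (volume.restrict D.Ω)⟩
      add_mem' := by
        rintro q r ⟨w, hw, hp, hq⟩ ⟨w', hw', hp', hr⟩
        refine ⟨w + w', hw.add hw', fun i x hx => by simp [hp i x hx, hp' i x hx], ?_⟩
        exact (Lp.coeFn_add (val q.1) (val r.1)).trans (hq.add hr)
      smul_mem' := by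
        rintro c q ⟨w, hw, hp, hq⟩
        refine ⟨c • w, hw.const_smul c, fun i x hx => by simp [hp i x hx], ?_⟩
        refine (Lp.coeFn_smul c (val q.1)).trans ?_
        filter_upwards [hq] with x hx
        simp [hx] }
  have hinj : Function.Injective (LinearMap.snd ℝ _ _ ∘ₗ R.subtype) := by
    refine (injective_iff_map_eq_zero _).2 ?_
    rintro ⟨⟨u, p⟩, w, hw, hp, hq⟩ h0
    have hp0 : p = 0 := h0
    subst hp0
    have hu : u = 0 := by
      refine eq_zero_of_ae_eq_zero hq ?_
      filter_upwards [ae_restrict_mem D.isOpen.measurableSet] with x hx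
      obtain ⟨i, y, hy, rfl⟩ := T.exists_mem_cell (subset_closure hx)
      simp [hp i y hy]
    subst hu
    rfl
  have hR : FiniteDimensional ℝ R := Module.Finite.of_injective _ hinj
  let F : R →ₗ[ℝ] D.Vh T k := (LinearMap.fst ℝ _ _ ∘ₗ R.subtype).codRestrict _ (by
    rintro ⟨⟨u, p⟩, w, hw, hp, hq⟩
    exact ⟨w, ⟨hw, fun i => ⟨p i, (p i).2, hp i⟩⟩, hq⟩)
  refine Module.Finite.of_surjective F ?_
  rintro ⟨u, hu⟩
  obtain ⟨w, ⟨hw, hp⟩, hq⟩ := id hu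
  choose p hpm hpe using hp
  exact ⟨⟨(u, fun i => ⟨p i, hpm i⟩), w, hw, hpe, hq⟩, rfl⟩

theorem Lh_le_Vh : D.Lh T k ≤ D.Vh T k := inf_le_left

instance finiteDimensional_Lh : FiniteDimensional ℝ (D.Lh T k) :=
  Submodule.finiteDimensional_of_le Lh_le_Vh

end AnisotropicData

/-! ### The energies as bilinear forms -/

namespace AnisotropicData

variable {d : ℕ} {D : AnisotropicData d}

theorem perp_add (x ξ η : Euc d) : D.perp x (ξ + η) = D.perp x ξ + D.perp x η := by
  simp only [perp, inner_add_right, add_smul]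
  abel

theorem perp_smul (x : Euc d) (c : ℝ) (ξ : Euc d) : D.perp x (c • ξ) = c • D.perp x ξ := by
  simp only [perp, real_inner_smul_right, smul_sub, smul_smul]

theorem A_add (x ξ η : Euc d) : D.A x (ξ + η) = D.A x ξ + D.A x η := by
  simp only [A, perp_add, inner_add_right, map_add, mul_add, add_smul]
  abel

theorem A_smul (x : Euc d) (c : ℝ) (ξ : Euc d) : D.A x (c • ξ) = c • D.A x ξ := by
  simp only [A, perp_smul, real_inner_smul_right, map_smul, smul_add, smul_smul]
  congr 2
  ring

theorem inner_perp_left (x ξ η : Euc d) :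
    (inner ℝ (D.perp x ξ) η : ℝ) = inner ℝ ξ (D.perp x η) := by
  simp only [perp, inner_sub_left, inner_sub_right, real_inner_smul_left, real_inner_smul_right,
    real_inner_comm (D.b x) ξ]
  ring

theorem inner_perp_b {x : Euc d} (hb : ‖D.b x‖ = 1) (ξ : Euc d) :
    (inner ℝ (D.perp x ξ) (D.b x) : ℝ) = 0 := by
  simp only [perp, inner_sub_left, real_inner_smul_left, real_inner_self_eq_norm_sq, hb,
    real_inner_comm (D.b x) ξ]
  ring

theorem norm_perp_le {x : Euc d} (hb : ‖D.b x‖ = 1) (ξ : Euc d) : ‖D.perp x ξ‖ ≤ ‖ξ‖ := by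
  refine le_of_sq_le_sq ?_ (norm_nonneg _)
  have h1 : ‖D.perp x ξ‖ ^ 2 = ‖ξ‖ ^ 2 - (inner ℝ (D.b x) ξ : ℝ) ^ 2 := by
    rw [perp, norm_sub_sq_real, norm_smul, hb, real_inner_smul_right, real_inner_comm ξ (D.b x),
      mul_one, Real.norm_eq_abs, sq_abs]
    ring
  rw [h1]
  nlinarith [sq_nonneg (inner ℝ (D.b x) ξ : ℝ)]

theorem inner_A (x ξ η : Euc d) : (inner ℝ (D.A x ξ) η : ℝ) =
    D.Apar x * ((inner ℝ (D.b x) ξ : ℝ) * inner ℝ (D.b x) η) +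
      inner ℝ (D.Aperp x (D.perp x ξ)) (D.perp x η) := by
  rw [A, inner_add_left, real_inner_smul_left, inner_perp_left, mul_assoc]

/-- The transversal part of the diffusion, as a bilinear form at the point `x`. -/
def perpForm (D : AnisotropicData d) (x : Euc d) : Euc d →ₗ[ℝ] Euc d →ₗ[ℝ] ℝ :=
  LinearMap.mk₂ ℝ (fun ξ η => inner ℝ (D.Aperp x (D.perp x ξ)) (D.perp x η))
    (fun _ _ _ => by rw [perp_add, map_add, inner_add_left])
    (fun _ _ _ => by rw [perp_smul, map_smul, real_inner_smul_left, smul_eq_mul])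
    (fun _ _ _ => by rw [perp_add, inner_add_right])
    (fun _ _ _ => by rw [perp_smul, real_inner_smul_right, smul_eq_mul])

theorem perpForm_apply (x ξ η : Euc d) :
    D.perpForm x ξ η = inner ℝ (D.Aperp x (D.perp x ξ)) (D.perp x η) := rfl

/-- Pointwise properties of the coefficients. -/
theorem Admissible.exists_pointwise_bounds (hD : D.Admissible) :
    ∃ A₀ A₁ : ℝ, 0 < A₀ ∧ ∀ᵐ x ∂volume.restrict D.Ω, ‖D.b x‖ = 1 ∧ A₀ ≤ D.Apar x ∧
      D.Apar x ≤ A₁ ∧ (∀ ξ η, D.perpForm x ξ η = D.perpForm x η ξ) ∧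
      (∀ ξ, A₀ * ‖D.perp x ξ‖ ^ 2 ≤ D.perpForm x ξ ξ) ∧
      ∀ ξ η, |D.perpForm x ξ η| ≤ A₁ * (‖ξ‖ * ‖η‖) := by
  obtain ⟨A₀, A₁, h0, h01, hA⟩ := hD.bounds
  refine ⟨A₀, A₁, h0, ?_⟩
  filter_upwards [hA, hD.Aperp_symm, ae_restrict_mem D.isOpen.measurableSet]
    with x ⟨⟨h1, h2⟩, h3⟩ h4 hx
  have hb := hD.b_unit x hx
  have hsymm : ∀ ξ η, D.perpForm x ξ η = D.perpForm x η ξ := fun ξ η => by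
    rw [perpForm_apply, perpForm_apply, h4 _ _ (inner_perp_b hb ξ) (inner_perp_b hb η),
      real_inner_comm]
  have hdiag : ∀ ξ, A₀ * ‖D.perp x ξ‖ ^ 2 ≤ D.perpForm x ξ ξ ∧
      D.perpForm x ξ ξ ≤ A₁ * ‖D.perp x ξ‖ ^ 2 := fun ξ => by
    rw [perpForm_apply, real_inner_comm]
    exact h3 _ (inner_perp_b hb ξ)
  have hnn : ∀ ξ, 0 ≤ D.perpForm x ξ ξ := fun ξ =>
    (mul_nonneg h0.le (sq_nonneg _)).trans (hdiag ξ).1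
  refine ⟨hb, h1, h2, hsymm, fun ξ => (hdiag ξ).1, fun ξ η => ?_⟩
  have hA1 : 0 ≤ A₁ := h0.le.trans h01
  have hsq : ∀ ξ, D.perpForm x ξ ξ ≤ A₁ * ‖ξ‖ ^ 2 := fun ξ => (hdiag ξ).2.trans
    (mul_le_mul_of_nonneg_left (pow_le_pow_left₀ (norm_nonneg _) (norm_perp_le hb ξ) 2) hA1)
  -- The hypotheses bound only the quadratic form of `A_⊥`; Cauchy-Schwarz for a symmetric
  -- nonnegative form extends the bound to pairs `ξ, η`.
  refine abs_le_of_sq_le_sq ?_ (by positivity)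
  calc D.perpForm x ξ η ^ 2 ≤ D.perpForm x ξ ξ * D.perpForm x η η :=
        LinearMap.BilinForm.apply_sq_le_of_symm (D.perpForm x) hnn ⟨fun ξ η => hsymm ξ η⟩ ξ η
    _ ≤ (A₁ * ‖ξ‖ ^ 2) * (A₁ * ‖η‖ ^ 2) :=
        mul_le_mul (hsq ξ) (hsq η) (hnn η) (by positivity)
    _ = (A₁ * (‖ξ‖ * ‖η‖)) ^ 2 := by ring

theorem inner_gradPar {x : Euc d} (hb : ‖D.b x‖ = 1) (u v : D.V) :
    (inner ℝ (D.gradPar u x) (D.gradPar v x) : ℝ) =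
      (inner ℝ (D.b x) (grad u x) : ℝ) * inner ℝ (D.b x) (grad v x) := by
  rw [gradPar, gradPar, real_inner_smul_left, real_inner_smul_right, real_inner_self_eq_norm_sq,
    hb]
  ring

theorem aestronglyMeasurable_b (D : AnisotropicData d) :
    AEStronglyMeasurable D.b (volume.restrict D.Ω) :=
  D.b_smooth.continuousOn.aestronglyMeasurable D.isOpen.measurableSet

theorem aestronglyMeasurable_grad (u : D.V) :
    AEStronglyMeasurable (grad u) (volume.restrict D.Ω) := Lp.aestronglyMeasurable _

theorem aestronglyMeasurable_perp (u : D.V) :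
    AEStronglyMeasurable (fun x => D.perp x (grad u x)) (volume.restrict D.Ω) :=
  (aestronglyMeasurable_grad u).sub
    ((D.aestronglyMeasurable_b.inner (𝕜 := ℝ) (aestronglyMeasurable_grad u)).smul
      D.aestronglyMeasurable_b)

theorem integrable_norm_grad_mul (u v : D.V) :
    Integrable (fun x => ‖grad u x‖ * ‖grad v x‖) (volume.restrict D.Ω) :=
  (Lp.memLp (grad u)).norm.integrable_mul (Lp.memLp (grad v)).norm

theorem Admissible.integrable_par (hD : D.Admissible) (u v : D.V) :
    Integrable (fun x => D.Apar x * (inner ℝ (D.gradPar u x) (D.gradPar v x) : ℝ))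
      (volume.restrict D.Ω) := by
  obtain ⟨A₀, A₁, h0, hA⟩ := hD.exists_pointwise_bounds
  have hm : ∀ u : D.V, AEStronglyMeasurable (D.gradPar u) (volume.restrict D.Ω) := fun u =>
    (D.aestronglyMeasurable_b.inner (𝕜 := ℝ) (aestronglyMeasurable_grad u)).smul
      D.aestronglyMeasurable_b
  refine ((integrable_norm_grad_mul u v).const_mul A₁).mono'
    (hD.Apar_meas.mul ((hm u).inner (𝕜 := ℝ) (hm v))) ?_
  filter_upwards [hA] with x ⟨hb, h1, h2, _⟩
  have h3 : ∀ ξ : Euc d, |(inner ℝ (D.b x) ξ : ℝ)| ≤ ‖ξ‖ := fun ξ => by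
    simpa [hb] using abs_real_inner_le_norm (D.b x) ξ
  rw [inner_gradPar hb, Real.norm_eq_abs, abs_mul, abs_mul, abs_of_pos (h0.trans_le h1)]
  exact mul_le_mul h2 (mul_le_mul (h3 _) (h3 _) (abs_nonneg _) (norm_nonneg _)) (by positivity)
    (h0.le.trans (h1.trans h2))

theorem Admissible.integrable_perpForm (hD : D.Admissible) (u v : D.V) :
    Integrable (fun x => D.perpForm x (grad u x) (grad v x)) (volume.restrict D.Ω) := by
  obtain ⟨A₀, A₁, h0, hA⟩ := hD.exists_pointwise_bounds
  have hm : AEStronglyMeasurable (fun x => D.Aperp x (D.perp x (grad u x)))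
      (volume.restrict D.Ω) :=
    (ContinuousLinearMap.id ℝ (Euc d →L[ℝ] Euc d)).aestronglyMeasurable_comp₂ hD.Aperp_meas
      (aestronglyMeasurable_perp u)
  refine ((integrable_norm_grad_mul u v).const_mul A₁).mono'
    (hm.inner (𝕜 := ℝ) (aestronglyMeasurable_perp v)) ?_
  filter_upwards [hA] with x ⟨_, _, _, _, _, h⟩
  exact h _ _

theorem Admissible.ae_inner_A (hD : D.Admissible) (u v : D.V) :
    (fun x => (inner ℝ (D.A x (grad u x)) (grad v x) : ℝ)) =ᵐ[volume.restrict D.Ω]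
      fun x => D.Apar x * (inner ℝ (D.gradPar u x) (D.gradPar v x) : ℝ) +
        D.perpForm x (grad u x) (grad v x) := by
  obtain ⟨A₀, A₁, h0, hA⟩ := hD.exists_pointwise_bounds
  filter_upwards [hA] with x ⟨hb, _⟩
  rw [inner_A, inner_gradPar hb, perpForm_apply]

theorem Admissible.integrable_full (hD : D.Admissible) (u v : D.V) :
    Integrable (fun x => (inner ℝ (D.A x (grad u x)) (grad v x) : ℝ)) (volume.restrict D.Ω) :=
  ((hD.integrable_par u v).add (hD.integrable_perpForm u v)).congr (hD.ae_inner_A u v).symm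

/-- The cross terms between the parallel and transversal parts vanish. The remaining transversal
integral is nonnegative on the diagonal, hence `a_∥ ≤ a` there. -/
theorem Admissible.a_eq (hD : D.Admissible) (u v : D.V) :
    D.a u v = D.aPar u v + ∫ x in D.Ω, D.perpForm x (grad u x) (grad v x) := by
  rw [a, integral_congr_ae (hD.ae_inner_A u v),
    integral_add (hD.integrable_par u v) (hD.integrable_perpForm u v), aPar]

theorem coeFn_grad_add (u v : D.V) :
    grad (u + v) =ᵐ[volume.restrict D.Ω] fun x => grad u x + grad v x :=
  Lp.coeFn_add (grad u) (grad v)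

theorem coeFn_grad_smul (c : ℝ) (u : D.V) :
    grad (c • u) =ᵐ[volume.restrict D.Ω] fun x => c • grad u x :=
  Lp.coeFn_smul c (grad u)

theorem aPar_comm (u v : D.V) : D.aPar u v = D.aPar v u := by
  simp only [aPar, real_inner_comm]

theorem Admissible.a_comm (hD : D.Admissible) (u v : D.V) : D.a u v = D.a v u := by
  rw [hD.a_eq, hD.a_eq, aPar_comm]
  congr 1
  obtain ⟨A₀, A₁, h0, hA⟩ := hD.exists_pointwise_bounds
  refine integral_congr_ae ?_
  filter_upwards [hA] with x ⟨_, _, _, h, _⟩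
  exact h _ _

theorem Admissible.a_add_left (hD : D.Admissible) (u v w : D.V) :
    D.a (u + v) w = D.a u w + D.a v w := by
  rw [a, a, a, ← integral_add (hD.integrable_full u w) (hD.integrable_full v w)]
  refine integral_congr_ae ?_
  filter_upwards [coeFn_grad_add u v] with x hx
  rw [hx, A_add, inner_add_left]

theorem a_smul_left (c : ℝ) (u w : D.V) : D.a (c • u) w = c * D.a u w := by
  rw [a, a, ← integral_const_mul]
  refine integral_congr_ae ?_
  filter_upwards [coeFn_grad_smul c u] with x hx
  rw [hx, A_smul, real_inner_smul_left]

theorem Admissible.aPar_add_left (hD : D.Admissible) (u v w : D.V) :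
    D.aPar (u + v) w = D.aPar u w + D.aPar v w := by
  rw [aPar, aPar, aPar, ← integral_add (hD.integrable_par u w) (hD.integrable_par v w)]
  refine integral_congr_ae ?_
  filter_upwards [coeFn_grad_add u v] with x hx
  simp only [gradPar, hx, inner_add_right, add_smul, inner_add_left, mul_add]

theorem aPar_smul_left (c : ℝ) (u w : D.V) : D.aPar (c • u) w = c * D.aPar u w := by
  rw [aPar, aPar, ← integral_const_mul]
  refine integral_congr_ae ?_
  filter_upwards [coeFn_grad_smul c u] with x hx
  simp only [gradPar, hx, real_inner_smul_right, real_inner_smul_left]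
  ring

/-- The form `a` as a bilinear form. -/
def Admissible.aForm (hD : D.Admissible) : D.V →ₗ[ℝ] D.V →ₗ[ℝ] ℝ :=
  LinearMap.mk₂ ℝ D.a hD.a_add_left a_smul_left
    (fun u v w => by rw [hD.a_comm, hD.a_add_left, hD.a_comm v, hD.a_comm w])
    (fun c u v => by rw [hD.a_comm, a_smul_left, hD.a_comm v, smul_eq_mul])

/-- The form `a_∥` as a bilinear form. -/
def Admissible.aParForm (hD : D.Admissible) : D.V →ₗ[ℝ] D.V →ₗ[ℝ] ℝ :=
  LinearMap.mk₂ ℝ D.aPar hD.aPar_add_left aPar_smul_left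
    (fun u v w => by rw [aPar_comm, hD.aPar_add_left, aPar_comm v, aPar_comm w])
    (fun c u v => by rw [aPar_comm, aPar_smul_left, aPar_comm v, smul_eq_mul])

theorem Admissible.aForm_apply (hD : D.Admissible) (u v : D.V) : hD.aForm u v = D.a u v := rfl

theorem Admissible.aParForm_apply (hD : D.Admissible) (u v : D.V) :
    hD.aParForm u v = D.aPar u v := rfl

theorem Admissible.ae_par_nonneg (hD : D.Admissible) (u : D.V) : ∀ᵐ x ∂volume.restrict D.Ω,
    0 ≤ D.Apar x * (inner ℝ (D.gradPar u x) (D.gradPar u x) : ℝ) := by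
  obtain ⟨A₀, A₁, h0, hA⟩ := hD.exists_pointwise_bounds
  filter_upwards [hA] with x ⟨_, h1, _⟩
  exact mul_nonneg (h0.le.trans h1) real_inner_self_nonneg

theorem Admissible.ae_perpForm_nonneg (hD : D.Admissible) (u : D.V) :
    ∀ᵐ x ∂volume.restrict D.Ω, 0 ≤ D.perpForm x (grad u x) (grad u x) := by
  obtain ⟨A₀, A₁, h0, hA⟩ := hD.exists_pointwise_bounds
  filter_upwards [hA] with x ⟨_, _, _, _, h, _⟩
  exact (mul_nonneg h0.le (sq_nonneg _)).trans (h _)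

theorem Admissible.aPar_self_nonneg (hD : D.Admissible) (u : D.V) : 0 ≤ D.aPar u u :=
  integral_nonneg_of_ae (hD.ae_par_nonneg u)

theorem Admissible.aPar_self_le (hD : D.Admissible) (u : D.V) : D.aPar u u ≤ D.a u u := by
  rw [hD.a_eq]
  exact le_add_of_nonneg_right (integral_nonneg_of_ae (hD.ae_perpForm_nonneg u))

theorem Admissible.ae_inner_b_grad_eq_zero (hD : D.Admissible) {u : D.V} (hu : D.aPar u u = 0) :
    ∀ᵐ x ∂volume.restrict D.Ω, (inner ℝ (D.b x) (grad u x) : ℝ) = 0 := by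
  obtain ⟨A₀, A₁, h0, hA⟩ := hD.exists_pointwise_bounds
  filter_upwards [hA, (integral_eq_zero_iff_of_nonneg_ae (hD.ae_par_nonneg u)
    (hD.integrable_par u u)).1 hu] with x ⟨hb, h1, _⟩ hx
  rw [inner_gradPar hb, Pi.zero_apply] at hx
  exact mul_self_eq_zero.1 ((mul_eq_zero.1 hx).resolve_left (h0.trans_le h1).ne')

theorem Admissible.ae_grad_eq_zero (hD : D.Admissible) {u : D.V} (hu : D.a u u = 0) :
    ∀ᵐ x ∂volume.restrict D.Ω, grad u x = 0 := by
  have hpar : D.aPar u u = 0 :=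
    le_antisymm (hu ▸ hD.aPar_self_le u) (hD.aPar_self_nonneg u)
  have hperp : ∫ x in D.Ω, D.perpForm x (grad u x) (grad u x) = 0 := by
    have := hD.a_eq u u
    rw [hu, hpar, zero_add] at this
    exact this.symm
  obtain ⟨A₀, A₁, h0, hA⟩ := hD.exists_pointwise_bounds
  filter_upwards [hA, hD.ae_inner_b_grad_eq_zero hpar,
    (integral_eq_zero_iff_of_nonneg_ae (hD.ae_perpForm_nonneg u)
      (hD.integrable_perpForm u u)).1 hperp] with x ⟨_, _, _, _, h, _⟩ h1 h2
  have h3 := h (grad u x)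
  rw [h2, Pi.zero_apply] at h3
  have h4 : ‖D.perp x (grad u x)‖ ^ 2 ≤ 0 := by
    by_contra! hpos
    exact (mul_pos h0 hpos).not_ge h3
  have h5 : D.perp x (grad u x) = 0 := by
    rw [← norm_eq_zero]
    exact pow_eq_zero_iff two_ne_zero |>.1 (le_antisymm h4 (sq_nonneg _))
  rwa [perp, h1, zero_smul, sub_zero] at h5

theorem Admissible.a_self_nonneg (hD : D.Admissible) (u : D.V) : 0 ≤ D.a u u :=
  (hD.aPar_self_nonneg u).trans (hD.aPar_self_le u)

variable {s : CellShape} {h : ℝ} {T : FEMesh D.Ω s h} {k : ℕ}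

theorem Admissible.eq_zero_of_a_self_eq_zero (hD : D.Admissible) (hd : 1 ≤ d) {u : D.V}
    (hu : u ∈ D.Vh T k) (h0 : D.a u u = 0) : u = 0 :=
  hD.eq_zero_of_grad_eq_zero hd hu (hD.ae_grad_eq_zero h0)

theorem Admissible.eq_zero_of_aPar_self_eq_zero (hD : D.Admissible) (hd : 1 ≤ d) {u : D.V}
    (hu : u ∈ D.Lh T k) (h0 : D.aPar u u = 0) : u = 0 :=
  hD.eq_zero_of_fieldDeriv_eq_zero hd hu (hD.ae_inner_b_grad_eq_zero h0)

end AnisotropicData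

/-! ### Stability of the discrete problem -/

theorem surjective_dual_of_injective {E : Type*} [AddCommGroup E] [Module ℝ E]
    [FiniteDimensional ℝ E] (B : E →ₗ[ℝ] Module.Dual ℝ E) (hB : Function.Injective B) :
    Function.Surjective B :=
  (LinearMap.injective_iff_surjective_of_finrank_eq_finrank Subspace.dual_finrank_eq.symm).1 hB

/-! The scalar inequalities behind the inf-sup condition: `x`, `σ`, `p` stand for `|u|_𝒱`,
`|q|_{*h}`, `|q|_∥`, and `m` for `a_∥(q,u)`. -/

theorem test_coercive {ε x p m : ℝ} (hε : 0 ≤ ε) (hm : m ≤ p * x) :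
    x ^ 2 + ε * p ^ 2 ≤ 2 * (1 + ε) * (x ^ 2 - 2 * ε * m + (1 + ε) * ε * p ^ 2) := by
  -- Completing the square. It remains to use `x² ≤ 2 (x - ε p)² + 2 ε² p²`, which is where the
  -- factor `2 (1 + ε)` comes from.
  have h1 : (x - ε * p) ^ 2 + ε * p ^ 2 ≤ x ^ 2 - 2 * ε * m + (1 + ε) * ε * p ^ 2 := by
    nlinarith [mul_le_mul_of_nonneg_left hm hε]
  refine le_trans ?_ (mul_le_mul_of_nonneg_left h1 (by positivity))
  nlinarith [sq_nonneg (x - 2 * ε * p), mul_nonneg hε (sq_nonneg (x - ε * p)),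
    mul_nonneg hε (sq_nonneg p)]

/-- The left side is the squared norm of the test element. Young's inequality bounds its first three
terms by `2 x² + 2 σ²`, and `2 + (1 + ε)² ≤ (2 + ε)²`. -/
theorem test_bound {ε κ x p σ m : ℝ} (hε : 0 ≤ ε) (hκ : 0 ≤ κ) (hκ1 : κ ≤ 1) (hm : m ≤ σ * x) :
    x ^ 2 + 2 * κ * m + κ ^ 2 * σ ^ 2 + (1 + ε) ^ 2 * (σ ^ 2 + ε * p ^ 2) ≤
      (2 + ε) ^ 2 * (x ^ 2 + σ ^ 2 + ε * p ^ 2) := by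
  have h1 : 2 * κ * m ≤ x ^ 2 + κ ^ 2 * σ ^ 2 := by
    nlinarith [mul_le_mul_of_nonneg_left hm hκ, sq_nonneg (x - κ * σ)]
  have h2 : κ ^ 2 * σ ^ 2 ≤ σ ^ 2 := mul_le_of_le_one_left (sq_nonneg _) (pow_le_one₀ hκ hκ1)
  have h3 : 0 ≤ ε * p ^ 2 := by positivity
  nlinarith [mul_nonneg hε (sq_nonneg x), mul_nonneg hε (sq_nonneg σ), mul_nonneg hε h3,
    sq_nonneg (ε * x), sq_nonneg x, sq_nonneg σ]

theorem test_lower {ε x p σ m : ℝ} (hε : 0 ≤ ε) (hm : m ≤ p * x) (hm' : -(σ * x) ≤ m)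
    (hσ : 0 ≤ σ) (hσp : σ ≤ p) : ∃ κ : ℝ, 0 ≤ κ ∧ κ ≤ 1 ∧ x ^ 2 + σ ^ 2 + ε * p ^ 2 ≤
      24 * (1 + ε) * (x ^ 2 + κ * m + (1 - ε) * κ * σ ^ 2 - 2 * ε * m + (1 + ε) * ε * p ^ 2) := by
  have hcoer := test_coercive hε hm
  have hp : 0 ≤ ε * p ^ 2 := by positivity
  rcases le_total ε (1 / 2) with hε2 | hε2
  -- For `ε ≤ 1/2` the coercive part is at least a third of `x² + ε p²`, and `(1 - ε) κ ≥ 1/12`. The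
  -- choice `κ = 1/6` lets the cross term be absorbed through `(σ - 2 x)² ≥ 0`, leaving `σ² / 24`.
  · refine ⟨1 / 6, by norm_num, by norm_num, ?_⟩
    have h1 : x ^ 2 / 3 + ε * p ^ 2 / 3 ≤ x ^ 2 - 2 * ε * m + (1 + ε) * ε * p ^ 2 := by
      have : 0 ≤ x ^ 2 - 2 * ε * m + (1 + ε) * ε * p ^ 2 := by
        have h0 : 0 ≤ x ^ 2 + ε * p ^ 2 := by positivity
        exact nonneg_of_mul_nonneg_right (h0.trans hcoer) (by positivity)
      have := mul_nonneg (sub_nonneg.2 hε2) this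
      linarith
    have h2 : x ^ 2 / 6 + σ ^ 2 / 24 + ε * p ^ 2 / 3 ≤ x ^ 2 + 1 / 6 * m
        + (1 - ε) * (1 / 6) * σ ^ 2 - 2 * ε * m + (1 + ε) * ε * p ^ 2 := by
      have := mul_nonneg (sub_nonneg.2 hε2) (sq_nonneg σ)
      linarith [sq_nonneg (σ - 2 * x)]
    have h4 : 0 ≤ x ^ 2 / 6 + σ ^ 2 / 24 + ε * p ^ 2 / 3 := by positivity
    have := mul_nonneg hε (h4.trans h2)
    linarith [sq_nonneg x]
  -- Here `1 - ε` may be negative, but `σ ≤ p` already gives `σ² ≤ 2 ε p²`, so no multiple of `r` is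
  -- needed.
  · refine ⟨0, le_rfl, zero_le_one, ?_⟩
    have h1 : σ ^ 2 ≤ 2 * (ε * p ^ 2) := by
      have := pow_le_pow_left₀ hσ hσp 2
      have := mul_nonneg (sub_nonneg.2 hε2) (sq_nonneg p)
      linarith
    linarith [sq_nonneg x]

/-! ### The discrete norms and the inf-sup condition -/

namespace AnisotropicData

variable {d : ℕ} {D : AnisotropicData d}

theorem normV_nonneg (v : D.V) : 0 ≤ D.normV v := Real.sqrt_nonneg _

theorem normPar_nonneg (v : D.V) : 0 ≤ D.normPar v := Real.sqrt_nonneg _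

theorem normV_smul (c : ℝ) (hD : D.Admissible) (v : D.V) :
    D.normV (c • v) = |c| * D.normV v := by
  rw [normV, normV, ← hD.aForm_apply, map_smul, map_smul, LinearMap.smul_apply, smul_eq_mul,
    smul_eq_mul, ← mul_assoc, Real.sqrt_mul (mul_self_nonneg c), Real.sqrt_mul_self_eq_abs,
    hD.aForm_apply]

theorem Admissible.sq_normV (hD : D.Admissible) (v : D.V) : D.normV v ^ 2 = D.a v v := Real.sq_sqrt (hD.a_self_nonneg v)

theorem Admissible.sq_normPar (hD : D.Admissible) (v : D.V) : D.normPar v ^ 2 = D.aPar v v :=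
  Real.sq_sqrt (hD.aPar_self_nonneg v)

theorem Admissible.normPar_le_normV (hD : D.Admissible) (v : D.V) : D.normPar v ≤ D.normV v :=
  Real.sqrt_le_sqrt (hD.aPar_self_le v)

theorem Admissible.abs_a_le (hD : D.Admissible) (u v : D.V) : |D.a u v| ≤ D.normV u * D.normV v := by
  refine abs_le_of_sq_le_sq ?_ (mul_nonneg (normV_nonneg _) (normV_nonneg _))
  rw [mul_pow, hD.sq_normV, hD.sq_normV]
  exact LinearMap.BilinForm.apply_sq_le_of_symm hD.aForm hD.a_self_nonneg ⟨hD.a_comm⟩ u v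

theorem Admissible.abs_aPar_le (hD : D.Admissible) (u v : D.V) : |D.aPar u v| ≤ D.normPar u * D.normPar v := by
  refine abs_le_of_sq_le_sq ?_ (mul_nonneg (normPar_nonneg _) (normPar_nonneg _))
  rw [mul_pow, hD.sq_normPar, hD.sq_normPar]
  exact LinearMap.BilinForm.apply_sq_le_of_symm hD.aParForm hD.aPar_self_nonneg ⟨aPar_comm⟩ u v

theorem Admissible.sq_normV_add_smul (hD : D.Admissible) (u r : D.V) (c : ℝ) :
    D.normV (u + c • r) ^ 2 = D.normV u ^ 2 + 2 * c * D.a u r + c ^ 2 * D.normV r ^ 2 := by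
  have h1 : D.a r u = D.a u r := hD.a_comm r u
  simp only [hD.sq_normV, ← hD.aForm_apply, map_add, map_smul, LinearMap.add_apply,
    LinearMap.smul_apply, smul_eq_mul] at h1 ⊢
  rw [h1]
  ring

theorem Admissible.sq_normPar_smul (hD : D.Admissible) (c : ℝ) (q : D.V) :
    D.normPar (c • q) ^ 2 = c ^ 2 * D.normPar q ^ 2 := by
  rw [hD.sq_normPar, hD.sq_normPar, aPar_smul_left, aPar_comm, aPar_smul_left]
  ring

variable {s : CellShape} {h : ℝ} {T : FEMesh D.Ω s h} {k : ℕ}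

/-- The elements of `V_h` represent the linear functionals on `V_h`. -/
theorem Admissible.exists_forall_a_eq (hD : D.Admissible) (hd : 1 ≤ d) (l : D.Vh T k →ₗ[ℝ] ℝ) :
    ∃ r : D.Vh T k, ∀ v : D.Vh T k, D.a r v = l v := by
  let B : D.Vh T k →ₗ[ℝ] Module.Dual ℝ (D.Vh T k) :=
    hD.aForm.domRestrict₁₂ (D.Vh T k) (D.Vh T k)
  have hB : ∀ u v : D.Vh T k, B u v = D.a u v := fun u v => rfl
  have hinj : Function.Injective B := by
    refine (injective_iff_map_eq_zero _).2 fun u hu => ?_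
    refine Subtype.ext (hD.eq_zero_of_a_self_eq_zero hd u.2 ?_)
    rw [← hB, hu, LinearMap.zero_apply]
  obtain ⟨r, hr⟩ := surjective_dual_of_injective (E := D.Vh T k) B hinj l
  exact ⟨r, fun v => by rw [← hB, hr]⟩

/-- Cauchy-Schwarz bounds every quotient by `|r|_𝒱`, and `v = r` attains it. -/
theorem Admissible.normStar_eq_of_forall (hD : D.Admissible) {q : D.V} {r : D.Vh T k}
    (hr : ∀ v : D.Vh T k, D.a r v = D.aPar q v) : D.normStar T k q = D.normV r := by
  have hle : ∀ v : D.Vh T k, D.aPar q v / D.normV v ≤ D.normV r := fun v => by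
    refine div_le_of_le_mul₀ (normV_nonneg _) (normV_nonneg _) ?_
    rw [← hr]
    exact (le_abs_self _).trans (hD.abs_a_le _ _)
  refine le_antisymm (ciSup_le hle) ?_
  refine le_trans (le_of_eq ?_) (le_ciSup ⟨D.normV r, forall_mem_range.2 hle⟩ r)
  rw [← hr, ← hD.sq_normV, sq, mul_self_div_self]

theorem Admissible.exists_normStar_eq (hD : D.Admissible) (hd : 1 ≤ d) (q : D.V) :
    ∃ r : D.Vh T k, (∀ v : D.Vh T k, D.a r v = D.aPar q v) ∧ D.normStar T k q = D.normV r := by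
  obtain ⟨r, hr⟩ := hD.exists_forall_a_eq hd ((hD.aParForm q).domRestrict (D.Vh T k))
  exact ⟨r, hr, hD.normStar_eq_of_forall hr⟩

theorem Admissible.normStar_nonneg (hD : D.Admissible) (hd : 1 ≤ d) (q : D.V) :
    0 ≤ D.normStar T k q := by
  obtain ⟨r, -, hr⟩ := hD.exists_normStar_eq (T := T) (k := k) hd q
  exact hr ▸ normV_nonneg _

theorem Admissible.abs_aPar_le_normStar_mul (hD : D.Admissible) (hd : 1 ≤ d) (q : D.V)
    {v : D.V} (hv : v ∈ D.Vh T k) : |D.aPar q v| ≤ D.normStar T k q * D.normV v := by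
  obtain ⟨r, h1, h2⟩ := hD.exists_normStar_eq (T := T) (k := k) hd q
  rw [h2, ← h1 ⟨v, hv⟩]
  exact hD.abs_a_le _ _

/-- With `r` the representative, `|r|_𝒱² = a_∥(q,r) ≤ |q|_∥ |r|_∥ ≤ |q|_∥ |r|_𝒱`. -/
theorem Admissible.normStar_le_normPar (hD : D.Admissible) (hd : 1 ≤ d) (q : D.V) :
    D.normStar T k q ≤ D.normPar q := by
  obtain ⟨r, h1, h2⟩ := hD.exists_normStar_eq (T := T) (k := k) hd q
  rw [h2]
  by_contra! hlt
  have h3 : D.normV r * D.normV r ≤ D.normPar q * D.normV r := by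
    rw [← sq, hD.sq_normV, h1]
    exact (le_abs_self _).trans ((hD.abs_aPar_le _ _).trans
      (mul_le_mul_of_nonneg_left (hD.normPar_le_normV _) (normPar_nonneg _)))
  exact (mul_lt_mul_of_pos_right hlt ((normPar_nonneg q).trans_lt hlt)).not_ge h3

theorem Admissible.normStar_smul (hD : D.Admissible) (hd : 1 ≤ d) (c : ℝ) (q : D.V) :
    D.normStar T k (c • q) = |c| * D.normStar T k q := by
  obtain ⟨r, h1, h2⟩ := hD.exists_normStar_eq (T := T) (k := k) hd q
  rw [h2, ← normV_smul c hD]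
  refine hD.normStar_eq_of_forall (r := c • r) fun v => ?_
  rw [Submodule.coe_smul, a_smul_left, h1, aPar_smul_left]

theorem normX_nonneg (ε : ℝ) (Φ : D.Vh T k × D.Lh T k) : 0 ≤ D.normX T k ε Φ := Real.sqrt_nonneg _

theorem sq_normX {ε : ℝ} (hε : 0 ≤ ε) (Φ : D.Vh T k × D.Lh T k) :
    D.normX T k ε Φ ^ 2 =
      D.normV Φ.1 ^ 2 + D.normStar T k Φ.2 ^ 2 + ε * D.normPar Φ.2 ^ 2 :=
  Real.sq_sqrt (by positivity)

theorem normV_fst_le_normX {ε : ℝ} (hε : 0 ≤ ε) (Φ : D.Vh T k × D.Lh T k) :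
    D.normV Φ.1 ≤ D.normX T k ε Φ := by
  refine le_of_sq_le_sq ?_ (normX_nonneg _ _)
  rw [sq_normX hε, add_assoc]
  exact le_add_of_nonneg_right (by positivity)

theorem normStar_snd_le_normX {ε : ℝ} (hε : 0 ≤ ε) (Φ : D.Vh T k × D.Lh T k) :
    D.normStar T k Φ.2 ≤ D.normX T k ε Φ := by
  refine le_of_sq_le_sq ?_ (normX_nonneg _ _)
  rw [sq_normX hε]
  nlinarith [sq_nonneg (D.normV Φ.1), mul_nonneg hε (sq_nonneg (D.normPar (Φ.2 : D.V)))]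

/-- The case `ε = 0` is included, since `q` itself is an admissible test in `|q|_{*h}` thanks to
`L_h ⊆ V_h`. -/
theorem Admissible.eq_zero_of_normX_eq_zero (hD : D.Admissible) (hd : 1 ≤ d) {ε : ℝ} (hε : 0 ≤ ε)
    {Φ : D.Vh T k × D.Lh T k} (h0 : D.normX T k ε Φ = 0) : Φ = 0 := by
  have h1 : D.normV Φ.1 = 0 :=
    le_antisymm (h0 ▸ normV_fst_le_normX hε Φ) (normV_nonneg _)
  have h2 : D.normStar T k Φ.2 = 0 :=
    le_antisymm (h0 ▸ normStar_snd_le_normX hε Φ) (hD.normStar_nonneg hd _)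
  refine Prod.ext (Subtype.ext ?_) (Subtype.ext ?_)
  · refine hD.eq_zero_of_a_self_eq_zero hd Φ.1.2 ?_
    rw [← hD.sq_normV, h1, sq, mul_zero]
  · refine hD.eq_zero_of_aPar_self_eq_zero hd Φ.2.2 ?_
    have h3 := hD.abs_aPar_le_normStar_mul (T := T) (k := k) hd Φ.2 (Lh_le_Vh Φ.2.2)
    rw [h2, zero_mul] at h3
    exact abs_eq_zero.1 (le_antisymm h3 (abs_nonneg _))

/-- `C_ε` as a bilinear form. -/
def Admissible.CForm (hD : D.Admissible) (T : FEMesh D.Ω s h) (k : ℕ) (ε : ℝ) :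
    (D.Vh T k × D.Lh T k) →ₗ[ℝ] (D.Vh T k × D.Lh T k) →ₗ[ℝ] ℝ :=
  LinearMap.mk₂ ℝ (D.C T k ε)
    (fun Φ Φ' Ψ => by
      simp only [C, ← hD.aForm_apply, ← hD.aParForm_apply, Prod.fst_add, Prod.snd_add,
        Submodule.coe_add, map_add, LinearMap.add_apply]
      ring)
    (fun c Φ Ψ => by
      simp only [C, ← hD.aForm_apply, ← hD.aParForm_apply, Prod.smul_fst, Prod.smul_snd,
        Submodule.coe_smul, map_smul, LinearMap.smul_apply, smul_eq_mul]
      ring)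
    (fun Φ Ψ Ψ' => by
      simp only [C, ← hD.aForm_apply, ← hD.aParForm_apply, Prod.fst_add, Prod.snd_add,
        Submodule.coe_add, map_add]
      ring)
    (fun c Φ Ψ => by
      simp only [C, ← hD.aForm_apply, ← hD.aParForm_apply, Prod.smul_fst, Prod.smul_snd,
        Submodule.coe_smul, map_smul, smul_eq_mul]
      ring)

theorem Admissible.CForm_apply (hD : D.Admissible) (ε : ℝ) (Φ Ψ : D.Vh T k × D.Lh T k) :
    hD.CForm T k ε Φ Ψ = D.C T k ε Φ Ψ := rfl

/-- This makes the supremum in the inf-sup condition a genuine one. Products with `w` are estimated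
by `|w|_{*h}` times a `𝒱`-norm, because `ε |w|_∥²` degenerates as `ε → 0`. -/
theorem Admissible.exists_abs_C_le (hD : D.Admissible) (hd : 1 ≤ d) {ε : ℝ} (hε : 0 ≤ ε)
    (Φ : D.Vh T k × D.Lh T k) :
    ∃ K, ∀ Ψ : D.Vh T k × D.Lh T k, |D.C T k ε Φ Ψ| ≤ K * D.normX T k ε Ψ := by
  refine ⟨D.normV Φ.1 + |1 - ε| * D.normStar T k Φ.2 + D.normV Φ.1 + ε * D.normV Φ.2,
    fun Ψ => ?_⟩
  have hv := normV_fst_le_normX hε Ψ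
  have hw := normStar_snd_le_normX hε Ψ
  have h1 : |D.a Φ.1 Ψ.1| ≤ D.normV Φ.1 * D.normX T k ε Ψ :=
    (hD.abs_a_le _ _).trans (mul_le_mul_of_nonneg_left hv (normV_nonneg _))
  have h2 : |(1 - ε) * D.aPar Φ.2 Ψ.1| ≤ |1 - ε| * D.normStar T k Φ.2 * D.normX T k ε Ψ := by
    rw [abs_mul, mul_assoc]
    refine mul_le_mul_of_nonneg_left ?_ (abs_nonneg _)
    exact (hD.abs_aPar_le_normStar_mul hd _ Ψ.1.2).trans
      (mul_le_mul_of_nonneg_left hv (hD.normStar_nonneg hd _))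
  have h3 : |D.aPar Φ.1 Ψ.2| ≤ D.normV Φ.1 * D.normX T k ε Ψ := by
    rw [aPar_comm, mul_comm]
    exact (hD.abs_aPar_le_normStar_mul hd _ Φ.1.2).trans
      (mul_le_mul_of_nonneg_right hw (normV_nonneg _))
  have h4 : |ε * D.aPar Φ.2 Ψ.2| ≤ ε * D.normV Φ.2 * D.normX T k ε Ψ := by
    rw [abs_mul, abs_of_nonneg hε, mul_assoc, aPar_comm, mul_comm (D.normV _)]
    refine mul_le_mul_of_nonneg_left ?_ hε
    exact (hD.abs_aPar_le_normStar_mul hd _ (Lh_le_Vh Φ.2.2)).trans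
      (mul_le_mul_of_nonneg_right hw (normV_nonneg _))
  rw [C, add_mul, add_mul, add_mul]
  refine (abs_sub _ _).trans (add_le_add ((abs_add_le _ _).trans (add_le_add ?_ h3)) h4)
  exact (abs_add_le _ _).trans (add_le_add h1 h2)

/-- A test element realizing the inf-sup condition. -/
theorem Admissible.exists_test (hD : D.Admissible) (hd : 1 ≤ d) {ε : ℝ} (hε : 0 ≤ ε)
    (Φ : D.Vh T k × D.Lh T k) : ∃ Ψ : D.Vh T k × D.Lh T k,
      D.normX T k ε Φ ^ 2 ≤ 24 * (1 + ε) * D.C T k ε Φ Ψ ∧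
      D.normX T k ε Ψ ≤ (2 + ε) * D.normX T k ε Φ := by
  obtain ⟨u, q⟩ := Φ
  obtain ⟨r, hr, hrn⟩ := hD.exists_normStar_eq (T := T) (k := k) hd q
  have hur : D.a u r = D.aPar q u := by rw [hD.a_comm, hr]
  have hrr : D.aPar q r = D.normStar T k q ^ 2 := by rw [← hr, ← hD.sq_normV, hrn]
  have hm1 : |D.aPar q u| ≤ D.normStar T k q * D.normV u :=
    hD.abs_aPar_le_normStar_mul hd _ u.2
  have hm2 : |D.aPar q u| ≤ D.normPar q * D.normV u := (hD.abs_aPar_le _ _).trans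
    (mul_le_mul_of_nonneg_left (hD.normPar_le_normV _) (normPar_nonneg _))
  have hsp := hD.normStar_le_normPar (T := T) (k := k) hd q
  have hs0 := hD.normStar_nonneg (T := T) (k := k) hd q
  -- With the factor `-(1 + ε)` the contributions `(1 - ε) a_∥(q,u)` and `-(1 + ε) a_∥(q,u)` leave
  -- only `-2 ε a_∥(q,u)`, small enough for the term `(1 + ε) ε |q|_∥²`.
  have hC : ∀ κ : ℝ, D.C T k ε (u, q) (u + κ • r, (-(1 + ε)) • q) =
      D.normV u ^ 2 + κ * D.aPar q u + (1 - ε) * κ * D.normStar T k q ^ 2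
        - 2 * ε * D.aPar q u + (1 + ε) * ε * D.normPar q ^ 2 := fun κ => by
    rw [hD.sq_normV, hD.sq_normPar, ← hrr]
    simp only [C, ← hD.aForm_apply, ← hD.aParForm_apply, Submodule.coe_add, Submodule.coe_smul,
      map_add, map_smul, smul_eq_mul] at hur ⊢
    rw [hur, hD.aParForm_apply u q, aPar_comm, ← hD.aParForm_apply]
    ring
  have hN : ∀ κ : ℝ, D.normX T k ε (u + κ • r, (-(1 + ε)) • q) ^ 2 =
      D.normV u ^ 2 + 2 * κ * D.aPar q u + κ ^ 2 * D.normStar T k q ^ 2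
        + (1 + ε) ^ 2 * (D.normStar T k q ^ 2 + ε * D.normPar q ^ 2) := fun κ => by
    have h1 : D.normX T k ε (u + κ • r, (-(1 + ε)) • q) ^ 2 =
        D.normV ((u : D.V) + κ • (r : D.V)) ^ 2
          + D.normStar T k ((-(1 + ε)) • (q : D.V)) ^ 2
          + ε * D.normPar ((-(1 + ε)) • (q : D.V)) ^ 2 := sq_normX hε _
    rw [h1, hD.sq_normV_add_smul, hD.sq_normPar_smul, hD.normStar_smul hd, mul_pow, sq_abs, hur,
      ← hrn]
    ring
  have hX : D.normX T k ε (u, q) ^ 2 =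
      D.normV u ^ 2 + D.normStar T k q ^ 2 + ε * D.normPar q ^ 2 := sq_normX hε _
  obtain ⟨κ, h0, h1, h2⟩ := test_lower hε (abs_le.1 hm2).2 (abs_le.1 hm1).1 hs0 hsp
  refine ⟨(u + κ • r, (-(1 + ε)) • q), by rw [hX, hC]; exact h2, ?_⟩
  refine le_of_sq_le_sq ?_ (mul_nonneg (by positivity) (normX_nonneg _ _))
  rw [hN, mul_pow, hX]
  exact test_bound hε h0 h1 (abs_le.1 hm1).2

/-- The inf-sup constant. -/
def infSupConst (ε : ℝ) : ℝ := (24 * (1 + ε) * (2 + ε))⁻¹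

theorem infSupConst_pos {ε : ℝ} (hε : 0 ≤ ε) : 0 < infSupConst ε := by
  unfold infSupConst
  positivity

theorem infSupConst_anti {ε ε' : ℝ} (hε : 0 ≤ ε) (h : ε ≤ ε') :
    infSupConst ε' ≤ infSupConst ε := by
  have : 0 ≤ ε' := hε.trans h
  unfold infSupConst
  gcongr

/-- The inf-sup condition freed of suprema: a bound on the functional `C_ε(Φ,·)` bounds `Φ`. The
inf-sup statement, uniqueness, the a priori estimate and the limit are all instances. -/
theorem Admissible.infSupConst_mul_normX_le (hD : D.Admissible) (hd : 1 ≤ d) {ε : ℝ}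
    (hε : 0 ≤ ε) {Φ : D.Vh T k × D.Lh T k} {K : ℝ} (hK : 0 ≤ K)
    (h : ∀ Ψ, D.C T k ε Φ Ψ ≤ K * D.normX T k ε Ψ) :
    infSupConst ε * D.normX T k ε Φ ≤ K := by
  obtain ⟨Ψ, h1, h2⟩ := hD.exists_test hd hε Φ
  rcases (normX_nonneg ε Φ).eq_or_lt with h0 | h0
  · rwa [← h0, mul_zero]
  rw [infSupConst, inv_mul_le_iff₀ (by positivity)]
  refine le_of_mul_le_mul_right ?_ h0
  calc D.normX T k ε Φ * D.normX T k ε Φ ≤ 24 * (1 + ε) * D.C T k ε Φ Ψ := by rwa [← sq]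
    _ ≤ 24 * (1 + ε) * (K * ((2 + ε) * D.normX T k ε Φ)) := by
        refine mul_le_mul_of_nonneg_left ((h Ψ).trans ?_) (by positivity)
        exact mul_le_mul_of_nonneg_left h2 hK
    _ = 24 * (1 + ε) * (2 + ε) * K * D.normX T k ε Φ := by ring

theorem Admissible.discreteInfSup (hD : D.Admissible) (hd : 1 ≤ d) {ε β : ℝ} (hε : 0 ≤ ε)
    (hβ : β ≤ infSupConst ε) : D.DiscreteInfSup T k ε β := by
  intro Φ
  obtain ⟨K, hK⟩ := hD.exists_abs_C_le hd hε Φ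
  have hbdd : BddAbove (range fun Ψ => D.C T k ε Φ Ψ / D.normX T k ε Ψ) := by
    refine ⟨max K 0, forall_mem_range.2 fun Ψ => ?_⟩
    refine div_le_of_le_mul₀ (normX_nonneg _ _) (le_max_right _ _) ?_
    exact ((le_abs_self _).trans (hK Ψ)).trans
      (mul_le_mul_of_nonneg_right (le_max_left _ _) (normX_nonneg _ _))
  refine (mul_le_mul_of_nonneg_right hβ (normX_nonneg _ _)).trans ?_
  refine hD.infSupConst_mul_normX_le hd hε ?_ fun Ψ => ?_
  · refine le_trans (le_of_eq ?_) (le_ciSup hbdd 0)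
    rw [← hD.CForm_apply, map_zero, zero_div]
  · rcases (normX_nonneg ε Ψ).eq_or_lt with h0 | h0
    · have h1 := hK Ψ
      rw [← h0, mul_zero] at h1 ⊢
      exact (le_abs_self _).trans h1
    · exact (div_le_iff₀ h0).1 (le_ciSup hbdd Ψ)

/-! ### Well-posedness, a priori bound and the limit `ε → 0` -/

theorem Admissible.eq_zero_of_forall_C_eq_zero (hD : D.Admissible) (hd : 1 ≤ d) {ε : ℝ}
    (hε : 0 ≤ ε) {Φ : D.Vh T k × D.Lh T k} (h : ∀ Ψ, D.C T k ε Φ Ψ = 0) : Φ = 0 := by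
  have h1 := hD.infSupConst_mul_normX_le hd hε le_rfl (Φ := Φ) fun Ψ => by rw [h Ψ, zero_mul]
  refine hD.eq_zero_of_normX_eq_zero hd hε (le_antisymm ?_ (normX_nonneg _ _))
  exact nonpos_of_mul_nonpos_right h1 (infSupConst_pos hε)

theorem Admissible.isDiscreteSolution_iff (hD : D.Admissible) {ε : ℝ} {f : D.V →ₗ[ℝ] ℝ}
    {Φ : D.Vh T k × D.Lh T k} :
    D.IsDiscreteSolution T k ε f Φ ↔ ∀ Ψ, D.C T k ε Φ Ψ = f Ψ.1 := by
  constructor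
  · rintro ⟨h1, h2⟩ Ψ
    have h3 := h1 Ψ.1
    have h4 := h2 Ψ.2
    rw [C, ← h3]
    linarith
  · refine fun h => ⟨fun v => ?_, fun w => ?_⟩
    · have h1 := h (v, 0)
      simpa [C, ← hD.aParForm_apply] using h1
    · have h1 := h (0, w)
      simpa [C, ← hD.aParForm_apply, ← hD.aForm_apply] using h1

theorem Admissible.existsUnique_isDiscreteSolution (hD : D.Admissible) (hd : 1 ≤ d) {ε : ℝ}
    (hε : 0 ≤ ε) (f : D.V →ₗ[ℝ] ℝ) :
    ∃! Φ : D.Vh T k × D.Lh T k, D.IsDiscreteSolution T k ε f Φ := by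
  have hinj : Function.Injective (hD.CForm T k ε) := by
    refine (injective_iff_map_eq_zero _).2 fun Φ hΦ => ?_
    refine hD.eq_zero_of_forall_C_eq_zero hd hε fun Ψ => ?_
    rw [← hD.CForm_apply, hΦ, LinearMap.zero_apply]
  obtain ⟨Φ, hΦ⟩ := surjective_dual_of_injective (E := D.Vh T k × D.Lh T k)
    (hD.CForm T k ε) hinj (f ∘ₗ (D.Vh T k).subtype ∘ₗ LinearMap.fst ℝ (D.Vh T k) (D.Lh T k))
  refine ⟨Φ, hD.isDiscreteSolution_iff.2 fun Ψ => ?_, fun Φ' hΦ' => hinj ?_⟩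
  · rw [← hD.CForm_apply, hΦ]
    rfl
  · rw [hΦ]
    exact LinearMap.ext fun Ψ => hD.isDiscreteSolution_iff.1 hΦ' Ψ

/-- Where `|v|_𝒱 = 0` the quotient says nothing, and the boundedness of `f` is used directly. -/
theorem IsBoundedFunctional.apply_le {f : D.V →ₗ[ℝ] ℝ} (hf : D.IsBoundedFunctional f) (v : D.V) :
    f v ≤ D.dualNorm f * D.normV v := by
  obtain ⟨C, hC⟩ := hf
  rcases (normV_nonneg v).eq_or_lt with h0 | h0
  · have h1 := hC v
    rw [← h0, mul_zero] at h1 ⊢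
    exact (le_abs_self _).trans h1
  · refine (div_le_iff₀ h0).1 (le_ciSup (f := fun v => f v / D.normV v) ⟨max C 0, ?_⟩ v)
    refine forall_mem_range.2 fun w => ?_
    refine div_le_of_le_mul₀ (normV_nonneg _) (le_max_right _ _) ?_
    exact ((le_abs_self _).trans (hC w)).trans
      (mul_le_mul_of_nonneg_right (le_max_left _ _) (normV_nonneg _))

theorem dualNorm_nonneg (f : D.V →ₗ[ℝ] ℝ) : 0 ≤ D.dualNorm f :=
  Real.iSup_nonneg' ⟨0, by simp⟩

theorem Admissible.normX_le_of_isDiscreteSolution (hD : D.Admissible) (hd : 1 ≤ d) {ε : ℝ}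
    (hε : 0 ≤ ε) {f : D.V →ₗ[ℝ] ℝ} (hf : D.IsBoundedFunctional f) {Φ : D.Vh T k × D.Lh T k}
    (hΦ : D.IsDiscreteSolution T k ε f Φ) :
    infSupConst ε * D.normX T k ε Φ ≤ D.dualNorm f := by
  refine hD.infSupConst_mul_normX_le hd hε (dualNorm_nonneg f) fun Ψ => ?_
  rw [hD.isDiscreteSolution_iff.1 hΦ]
  exact (hf.apply_le _).trans
    (mul_le_mul_of_nonneg_left (normV_fst_le_normX hε Ψ) (dualNorm_nonneg f))

/-- The rate is in fact `O(ε)`, with a constant involving `q_0` measured in `|·|_{*h}` and `|·|_𝒱`.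
-/
theorem Admissible.tendsto_normX_sub (hD : D.Admissible) (hd : 1 ≤ d) {f : D.V →ₗ[ℝ] ℝ}
    {U : ℝ → D.Vh T k × D.Lh T k} (hU : ∀ ε, 0 ≤ ε → D.IsDiscreteSolution T k ε f (U ε)) :
    Tendsto (fun ε => D.normX T k ε (U ε - U 0)) (𝓝[>] 0) (𝓝 0) := by
  set K : ℝ := D.normStar T k (U 0).2 + D.normV (U 0).2 with hKdef
  have hK : 0 ≤ K := add_nonneg (hD.normStar_nonneg hd _) (normV_nonneg _)
  have hbound : ∀ ε : ℝ, 0 ≤ ε → infSupConst ε * D.normX T k ε (U ε - U 0) ≤ ε * K := by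
    intro ε hε
    refine hD.infSupConst_mul_normX_le hd hε (mul_nonneg hε hK) fun Ψ => ?_
    have h1 : D.C T k ε (U ε - U 0) Ψ =
        ε * (D.aPar (U 0).2 Ψ.1 + D.aPar (U 0).2 Ψ.2) := by
      have hUε : U ε - U 0 + U 0 = U ε := sub_add_cancel (U ε) (U 0)
      -- Both solutions have the same right-hand side, so `C_ε(U_ε - U_0, ·) = (C_0 - C_ε)(U_0, ·)`.
      have h2 : D.C T k ε (U ε - U 0) Ψ + D.C T k ε (U 0) Ψ = D.C T k 0 (U 0) Ψ := by
        rw [hD.isDiscreteSolution_iff.1 (hU 0 le_rfl), ← hD.isDiscreteSolution_iff.1 (hU ε hε),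
          ← hD.CForm_apply, ← hD.CForm_apply, ← LinearMap.add_apply, ← map_add, hUε,
          hD.CForm_apply]
      rw [eq_sub_of_add_eq h2, C, C]
      ring
    rw [h1, mul_assoc]
    refine mul_le_mul_of_nonneg_left ?_ hε
    rw [hKdef, add_mul]
    refine add_le_add ((le_abs_self _).trans ?_) ((le_abs_self _).trans ?_)
    · exact (hD.abs_aPar_le_normStar_mul hd _ Ψ.1.2).trans
        (mul_le_mul_of_nonneg_left (normV_fst_le_normX hε Ψ) (hD.normStar_nonneg hd _))
    · rw [aPar_comm, mul_comm (D.normV _)]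
      exact (hD.abs_aPar_le_normStar_mul hd _ (Lh_le_Vh (U 0).2.2)).trans
        (mul_le_mul_of_nonneg_right (normStar_snd_le_normX hε Ψ) (normV_nonneg _))
  have hlim : Tendsto (fun ε : ℝ => (infSupConst 1)⁻¹ * (ε * K)) (𝓝[>] 0) (𝓝 0) := by
    have : Continuous fun ε : ℝ => (infSupConst 1)⁻¹ * (ε * K) := by fun_prop
    simpa using (this.tendsto 0).mono_left nhdsWithin_le_nhds
  refine squeeze_zero' (Eventually.of_forall fun ε => normX_nonneg _ _) ?_ hlim
  -- On `(0,1]` the constant at `ε = 1` is a common lower bound of the inf-sup constants.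
  filter_upwards [Ioc_mem_nhdsGT (zero_lt_one (α := ℝ))] with ε hε
  have h1 := infSupConst_pos (zero_le_one (α := ℝ))
  rw [← div_eq_inv_mul, le_div_iff₀ h1, mul_comm]
  exact (mul_le_mul_of_nonneg_right (infSupConst_anti hε.1.le hε.2) (normX_nonneg _ _)).trans
    (hbound ε hε.1.le)

/-! ### Conditioning of the linear system -/

variable {m n : ℕ} (βu : Module.Basis (Fin m) ℝ (D.Vh T k))
  (βq : Module.Basis (Fin n) ℝ (D.Lh T k))

/-- The transpose appears because the trial function is the first argument of `C_ε`, while the rows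
of the system belong to test functions. -/
theorem Admissible.systemMatrix_eq (hD : D.Admissible) (ε : ℝ) :
    D.systemMatrix T k βu βq ε =
      (LinearMap.toMatrix₂ (βu.prod βq) (βu.prod βq) (hD.CForm T k ε)).transpose := by
  ext i j
  rw [Matrix.transpose_apply, LinearMap.toMatrix₂_apply, hD.CForm_apply]
  rcases i with i | i <;> rcases j with j | j <;>
    simp [systemMatrix, C, ← hD.aForm_apply, ← hD.aParForm_apply]

theorem Admissible.isUnit_systemMatrix (hD : D.Admissible) (hd : 1 ≤ d) {ε : ℝ} (hε : 0 ≤ ε) :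
    IsUnit (D.systemMatrix T k βu βq ε) := by
  rw [Matrix.isUnit_iff_isUnit_det, isUnit_iff_ne_zero, hD.systemMatrix_eq, Matrix.det_transpose,
    ← LinearMap.separatingLeft_iff_det_ne_zero]
  intro Φ hΦ
  exact hD.eq_zero_of_forall_C_eq_zero hd hε hΦ

theorem continuous_systemMatrix : Continuous (D.systemMatrix T k βu βq) := by
  unfold systemMatrix
  refine Continuous.matrix_fromBlocks ?_ ?_ ?_ ?_ <;>
  · refine continuous_matrix fun i j => ?_
    simp only [Matrix.of_apply]
    fun_prop

/-- The determinant never vanishes on the compact interval, so the matrix, its inverse and both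
norms are continuous there. -/
theorem Admissible.exists_cond₂_le (hD : D.Admissible) (hd : 1 ≤ d) (εmax : ℝ) :
    ∃ K : ℝ, ∀ ε ∈ Icc 0 εmax, cond₂ (D.systemMatrix T k βu βq ε) ≤ K := by
  have hL : Continuous (Matrix.toEuclideanCLM (𝕜 := ℝ) (n := Fin m ⊕ Fin n)) :=
    LinearMap.continuous_of_finiteDimensional
      (Matrix.toEuclideanCLM (𝕜 := ℝ) (n := Fin m ⊕ Fin n)).toAlgEquiv.toLinearMap
  have hM := continuous_systemMatrix βu βq
  have hinv : ContinuousOn (fun ε => (D.systemMatrix T k βu βq ε)⁻¹) (Icc 0 εmax) := by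
    intro ε hε
    have hdet := (Matrix.isUnit_iff_isUnit_det _).1 (hD.isUnit_systemMatrix βu βq hd hε.1)
    have h1 : ContinuousAt Ring.inverse (D.systemMatrix T k βu βq ε).det := by
      rw [Ring.inverse_eq_inv']
      exact continuousAt_inv₀ hdet.ne_zero
    exact ((continuousAt_matrix_inv _ h1).comp hM.continuousAt).continuousWithinAt
  have hc : ContinuousOn (fun ε => cond₂ (D.systemMatrix T k βu βq ε)) (Icc 0 εmax) :=
    (hL.comp hM).norm.continuousOn.mul (hL.comp_continuousOn hinv).norm
  obtain ⟨K, hK⟩ := isCompact_Icc.bddAbove_image hc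
  exact ⟨K, fun ε hε => hK (mem_image_of_mem _ hε)⟩

end AnisotropicData

end

theorem mainTheorem4 (εmax : ℝ) :
    ∃ β : ℝ, 0 < β ∧
      ∀ (d : ℕ), (d = 2 ∨ d = 3) →
      ∀ (D : AnisotropicData d), D.Admissible →
      ∀ (s : CellShape) (h : ℝ) (T : FEMesh D.Ω s h) (k : ℕ),
        -- `β` is an inf-sup constant, independent of the mesh and of `ε`
        (∀ ε ∈ Set.Icc 0 εmax, D.DiscreteInfSup T k ε β) ∧
        (∀ f : D.V →ₗ[ℝ] ℝ, D.IsBoundedFunctional f →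
          -- existence and uniqueness
          (∀ ε : ℝ, 0 ≤ ε →
            ∃! Φ : D.Vh T k × D.Lh T k, D.IsDiscreteSolution T k ε f Φ) ∧
          -- a priori bound
          (∀ ε ∈ Set.Icc 0 εmax, ∀ Φ : D.Vh T k × D.Lh T k, D.IsDiscreteSolution T k ε f Φ →
            D.normX T k ε Φ ≤ 1 / β * D.dualNorm f) ∧
          -- convergence to the discrete limit solution
          (∀ U : ℝ → D.Vh T k × D.Lh T k, (∀ ε, 0 ≤ ε → D.IsDiscreteSolution T k ε f (U ε)) →
            Tendsto (fun ε => D.normX T k ε (U ε - U 0)) (𝓝[>] 0) (𝓝 0))) ∧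
        -- condition number
        (∀ (m n : ℕ) (βu : Module.Basis (Fin m) ℝ (D.Vh T k))
          (βq : Module.Basis (Fin n) ℝ (D.Lh T k)),
          ∃ K : ℝ, ∀ ε ∈ Set.Icc 0 εmax,
            IsUnit (D.systemMatrix T k βu βq ε) ∧ cond₂ (D.systemMatrix T k βu βq ε) ≤ K) := by
  -- `εmax` may be negative; the interval is then empty, and the truncation at `0` keeps `β`
  -- positive.
  have hE : (0 : ℝ) ≤ max εmax 0 := le_max_right _ _
  have hβ : ∀ ε ∈ Icc 0 εmax, AnisotropicData.infSupConst (max εmax 0) ≤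
      AnisotropicData.infSupConst ε := fun ε hε =>
    AnisotropicData.infSupConst_anti hε.1 (hε.2.trans (le_max_left _ _))
  refine ⟨AnisotropicData.infSupConst (max εmax 0), AnisotropicData.infSupConst_pos hE, ?_⟩
  intro d hd' D hD s h T k
  have hd : 1 ≤ d := by omega
  refine ⟨fun ε hε => hD.discreteInfSup hd hε.1 (hβ ε hε), fun f hf => ⟨fun ε hε => ?_,
    fun ε hε Φ hΦ => ?_, fun U hU => hD.tendsto_normX_sub hd hU⟩, fun m n βu βq => ?_⟩
  · exact hD.existsUnique_isDiscreteSolution hd hε f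
  · rw [one_div, le_inv_mul_iff₀ (AnisotropicData.infSupConst_pos hE)]
    exact (mul_le_mul_of_nonneg_right (hβ ε hε) (AnisotropicData.normX_nonneg _ _)).trans
      (hD.normX_le_of_isDiscreteSolution hd hε.1 hf hΦ)
  · obtain ⟨K, hK⟩ := hD.exists_cond₂_le βu βq hd εmax
    exact ⟨K, fun ε hε => ⟨hD.isUnit_systemMatrix βu βq hd hε.1, hK ε hε⟩⟩
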